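/- Let $m\ge 0$ be an integer, $\delta=\pm1$, and let $A,T$ be complex $(2m+2)\times(2m+2)$ matrices with $|A|=\det A\neq0$. For functions of $(n,t)\in\mathbb Z\times\mathbb R$ write $f_n=f_n(t)$, $f_{-n}(-t)=f(-n,-t)$; $*$ is the entrywise complex conjugate. Let $(q_n,r_n)$ be a complex-valued background solving $$\partial_tq_n=(1-q_nr_n)(q_{n+1}-q_{n-1}),\qquad \partial_tr_n=(1-q_nr_n)(r_{n+1}-r_{n-1}),$$ with $\alpha_n=1-q_nr_n$ nowhere zero, and let $\alpha_n^{1/2}$ be a choice of its square root. Let $\Phi_n,\Psi_n\in\mathbb C^{2m+2}$ depend on $(n,t)$, with $$\Phi_{n+1}=\alpha_n^{-1/2}(A\Phi_n+q_n\Psi_n),\qquad 2\partial_t\Phi_n=(A^2-A^{-2}+r_nq_{n-1}-q_nr_{n-1})\Phi_n+2(Aq_n+A^{-1}q_{n-1})\Psi_n, \quad (1)$$ and put $$F_n=\alpha_n^{(m+1)/2}|\Phi_{n+1},A^2\Phi_{n+1},\dots,A^{2m}\Phi_{n+1};\Psi_n,A^2\Psi_n,\dots,A^{2m}\Psi_n|,$$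 $$G_n=\alpha_n^{(m+1)/2}|\Phi_n,A\Phi_{n+1},A^3\Phi_{n+1},\dots,A^{2m+1}\Phi_{n+1};A\Psi_n,A^3\Psi_n,\dots,A^{2m-1}\Psi_n|,$$ $$H_n=\alpha_n^{(m+1)/2}|A\Phi_{n+1},A^3\Phi_{n+1},\dots,A^{2m-1}\Phi_{n+1};\Psi_{n+1},A\Psi_n,A^3\Psi_n,\dots,A^{2m+1}\Psi_n|,$$ $Q_n=G_n/F_n$, $R_n=H_n/F_n$. Suppose that one of the following sets of constraints holds. 1. (classical real) $r_n=\delta q_n$, $\Psi_n=T\Phi_n$, $A^{-1}T=TA$, $TT=\delta I$. 2. (classical complex) $r_n=\delta q_n^*$, $\Psi_n=T\Phi_n^*$, $A^{-1}T=TA^*$, $TT^*=\delta I$, and $\alpha_n^{1/2}$ is real. 3. (nonlocal real) $r_n=\delta q_{-n}(-t)$, $\Psi_n=T\Phi_{1-n}(-t)$, $AT=TA$, $TT=-\delta I$, and $\alpha_{-n}^{1/2}(-t)=\alpha_n^{1/2}(t)$. 4. (nonlocal complex) $r_n=\delta q^*_{-n}(-t)$, $\Psi_n=T\Phi^*_{1-n}(-t)$,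 $AT=TA^*$, $TT^*=-\delta I$, and $(\alpha_{-n}^{1/2}(-t))^*=\alpha_n^{1/2}(t)$. Then $\Psi_n$ satisfies the companion system $$\Psi_{n+1}=\alpha_n^{-1/2}(r_n\Phi_n+A^{-1}\Psi_n),\qquad 2\partial_t\Psi_n=2(Ar_{n-1}+A^{-1}r_n)\Phi_n+(A^{-2}-A^2-r_nq_{n-1}+q_nr_{n-1})\Psi_n,$$ and for all $(n,t)$, respectively, 1. $F_n=(-\delta)^{m+1}|A^{2m+1}T|^{-1}F_n$, $H_n=-(-\delta)^m|A^{2m+1}T|^{-1}G_n$; 2. $F_n=(-\delta)^{m+1}|A^{2m+1}T|F_n^*$, $H_n=-(-\delta)^m|A^{2m+1}T|G_n^*$; 3. $F_n=\delta^{m+1}|T|^{-1}F_{-n}(-t)$, $H_n=\delta^m|T|^{-1}G_{-n}(-t)$; 4. $F_n=\delta^{m+1}|T|F^*_{-n}(-t)$, $H_n=\delta^m|T|G^*_{-n}(-t)$. Hence, with $\hat Q_n=Q_n,\ Q_n^*,\ Q_{-n}(-t),\ Q^*_{-n}(-t)$ respectively, $R_n=\delta\hat Q_n$ wherever $F_n\ne0$,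 and $Q_n$ solves the corresponding classical real, classical complex, nonlocal real reverse-space-time or nonlocal complex reverse-space-time sd-mKdV equation $$\partial_tQ_n=(1-\delta Q_n\hat Q_n)(Q_{n+1}-Q_{n-1})$$ at every $(n,t)$ with $F_{n-1},F_n,F_{n+1}\neq0$ at time $t$. -/

import Mathlib

open scoped ComplexConjugate

noncomputable section

/-- A function of the lattice site `n ∈ ℤ` and the time `t ∈ ℝ`. -/
abbrev Field1 := ℤ → ℝ → ℂ

/-- A column vector with `2m+2` complex components, depending on `n ∈ ℤ` and `t ∈ ℝ`. -/
abbrev VecField (m : ℕ) := ℤ → ℝ → Fin (2 * m + 2) → ℂ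

/-- Square matrices of order `2m+2`. -/
abbrev Mat (m : ℕ) := Matrix (Fin (2 * m + 2)) (Fin (2 * m + 2)) ℂ

/-- Entrywise complex conjugate of a matrix (no transposition). -/
def Mat.cj {m : ℕ} (A : Mat m) : Mat m := A.map conj

/-- Entrywise complex conjugate of a vector. -/
def vecConj {m : ℕ} (v : Fin (2 * m + 2) → ℂ) : Fin (2 * m + 2) → ℂ := fun i => conj (v i)

/-- `(q, r)` solves the unreduced system
`∂ₜ qₙ = (1 - qₙ rₙ)(qₙ₊₁ - qₙ₋₁)`, `∂ₜ rₙ = (1 - qₙ rₙ)(rₙ₊₁ - rₙ₋₁)` on `ℤ × ℝ`. -/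
structure IsCoupledSolution (q r : Field1) : Prop where
  eq_q : ∀ n t, HasDerivAt (q n) ((1 - q n t * r n t) * (q (n + 1) t - q (n - 1) t)) t
  eq_r : ∀ n t, HasDerivAt (r n) ((1 - q n t * r n t) * (r (n + 1) t - r (n - 1) t)) t

/-- `s` is a choice of the square root `αₙ^{1/2}` of `αₙ = 1 - qₙ rₙ`, which has no zeros. -/
structure IsSqrtAlpha (q r s : Field1) : Prop where
  alpha_ne_zero : ∀ n t, 1 - q n t * r n t ≠ 0
  sq_eq : ∀ n t, s n t ^ 2 = 1 - q n t * r n t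

/-- First block row of the matrix system, i.e. the equations for `Φₙ`:
`Φₙ₊₁ = αₙ^{-1/2} (A Φₙ + qₙ Ψₙ)` and
`2 ∂ₜ Φₙ = (A² - A⁻² + rₙ qₙ₋₁ - qₙ rₙ₋₁) Φₙ + 2 (A qₙ + A⁻¹ qₙ₋₁) Ψₙ`. -/
structure PhiSystem {m : ℕ} (A : Mat m) (s q r : Field1) (Φ Ψ : VecField m) : Prop where
  space : ∀ n t, Φ (n + 1) t = (s n t)⁻¹ • (A.mulVec (Φ n t) + q n t • Ψ n t)
  time : ∀ n t, HasDerivAt (Φ n)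
    ((1 / 2 : ℂ) •
      ((A ^ 2 - A⁻¹ ^ 2 + (r n t * q (n - 1) t - q n t * r (n - 1) t) • (1 : Mat m)).mulVec (Φ n t)
        + ((2 * q n t) • A + (2 * q (n - 1) t) • A⁻¹).mulVec (Ψ n t))) t

/-- Second block row of the matrix system, i.e. the equations for `Ψₙ`:
`Ψₙ₊₁ = αₙ^{-1/2} (rₙ Φₙ + A⁻¹ Ψₙ)` and
`2 ∂ₜ Ψₙ = 2 (A rₙ₋₁ + A⁻¹ rₙ) Φₙ + (A⁻² - A² - (rₙ qₙ₋₁ - qₙ rₙ₋₁)) Ψₙ`. -/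
structure PsiSystem {m : ℕ} (A : Mat m) (s q r : Field1) (Φ Ψ : VecField m) : Prop where
  space : ∀ n t, Ψ (n + 1) t = (s n t)⁻¹ • (r n t • Φ n t + A⁻¹.mulVec (Ψ n t))
  time : ∀ n t, HasDerivAt (Ψ n)
    ((1 / 2 : ℂ) •
      (((2 * r (n - 1) t) • A + (2 * r n t) • A⁻¹).mulVec (Φ n t)
        + (A⁻¹ ^ 2 - A ^ 2 - (r n t * q (n - 1) t - q n t * r (n - 1) t) • (1 : Mat m)).mulVec
            (Ψ n t))) t

/-- `Fₙ = αₙ^{(m+1)/2} |Φₙ₊₁, A²Φₙ₊₁, …, A^{2m}Φₙ₊₁; Ψₙ, A²Ψₙ, …, A^{2m}Ψₙ|`. -/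
def casF {m : ℕ} (A : Mat m) (s : Field1) (Φ Ψ : VecField m) : Field1 := fun n t =>
  s n t ^ (m + 1) * Matrix.det (Matrix.of fun i j : Fin (2 * m + 2) =>
    (if j.val ≤ m then (A ^ (2 * j.val)).mulVec (Φ (n + 1) t)
      else (A ^ (2 * (j.val - (m + 1)))).mulVec (Ψ n t)) i)

/-- `Gₙ = αₙ^{(m+1)/2} |Φₙ, AΦₙ₊₁, A³Φₙ₊₁, …, A^{2m+1}Φₙ₊₁; AΨₙ, A³Ψₙ, …, A^{2m-1}Ψₙ|`. -/
def casG {m : ℕ} (A : Mat m) (s : Field1) (Φ Ψ : VecField m) : Field1 := fun n t =>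
  s n t ^ (m + 1) * Matrix.det (Matrix.of fun i j : Fin (2 * m + 2) =>
    (if j.val = 0 then Φ n t
      else if j.val ≤ m + 1 then (A ^ (2 * j.val - 1)).mulVec (Φ (n + 1) t)
      else (A ^ (2 * (j.val - (m + 2)) + 1)).mulVec (Ψ n t)) i)

/-- `Hₙ = αₙ^{(m+1)/2} |AΦₙ₊₁, A³Φₙ₊₁, …, A^{2m-1}Φₙ₊₁; Ψₙ₊₁, AΨₙ, A³Ψₙ, …, A^{2m+1}Ψₙ|`. -/
def casH {m : ℕ} (A : Mat m) (s : Field1) (Φ Ψ : VecField m) : Field1 := fun n t =>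
  s n t ^ (m + 1) * Matrix.det (Matrix.of fun i j : Fin (2 * m + 2) =>
    (if j.val < m then (A ^ (2 * j.val + 1)).mulVec (Φ (n + 1) t)
      else if j.val = m then Ψ (n + 1) t
      else (A ^ (2 * (j.val - (m + 1)) + 1)).mulVec (Ψ n t)) i)

/-- `Qₙ = Gₙ / Fₙ`. -/
def solQ {m : ℕ} (A : Mat m) (s : Field1) (Φ Ψ : VecField m) : Field1 := fun n t =>
  casG A s Φ Ψ n t / casF A s Φ Ψ n t

/-- `Rₙ = Hₙ / Fₙ`. -/
def solR {m : ℕ} (A : Mat m) (s : Field1) (Φ Ψ : VecField m) : Field1 := fun n t =>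
  casH A s Φ Ψ n t / casF A s Φ Ψ n t

/-- The equation `∂ₜ Qₙ = (1 - δ Qₙ Q̂ₙ)(Qₙ₊₁ - Qₙ₋₁)` holds at every `(n, t)` at which the
denominators `F` of `Qₙ₋₁`, `Qₙ`, `Qₙ₊₁` do not vanish. -/
def SolvesWhereDefined (δ : ℂ) (F Q Qhat : Field1) : Prop :=
  ∀ n t, F (n - 1) t ≠ 0 → F n t ≠ 0 → F (n + 1) t ≠ 0 →
    HasDerivAt (Q n) ((1 - δ * Q n t * Qhat n t) * (Q (n + 1) t - Q (n - 1) t)) t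

end

/-!
The proof has two independent halves: the Darboux covariance of the unreduced system, and the
symmetry of the determinants under the reductions.

Covariance. Put `M = A²`, `a = Φₙ`, `b = A⁻¹Ψₙ`. Column operations turn `F` into `|A|` times the
determinant of the vectors `M ^ j a`, `M ^ j b` with `j ≤ m` (`casF_eq_krylovDet`). Where it does
not vanish, these vectors form a basis, and expanding `M ^ (m + 1) a = x(M) a + y(M) b` and
`M ^ (m + 1) b = z(M) a + w(M) b` along it defines four polynomials of degree at most `m`
(`DarbouxRelation`): the pair `(a, b)` is annihilated by a unique monic `2 × 2` matrix polynomial of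
degree `m + 1`, the Darboux matrix of the transformation. By Cramer's rule `G / F` and `H / F` are,
up to the factor `1 / |A|`, the combinations `y₀ + qₙ w₀` and `rₙ w₀ - z₀` of its lowest
coefficients (`casG_eq_coeff`, `casH_eq_coeff`), and its lowest coefficient matrix has the constant
determinant `|A|²` (`DarbouxRelation.det_coeff_zero`).

Any other polynomial relation between `a` and `b` is a combination of the two basic ones, by
division with remainder and uniqueness. The Lax pair supplies two kinds of such relations: the
basic relations of the next site, pulled back by the space part (`DarbouxRelation.shift`), and the
time derivatives of the basic relations (`DarbouxRelation.evolve`). Both have low degree, so a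
comparison of a few extreme coefficients determines the multipliers completely. Eliminating them
gives `∂ₜ Q = (1 - Q R) (Q₊ - Q₋)` (`hasDerivAt_solQ`).

Reductions. With `σ` the identity or complex conjugation, all four cases relate `Ψ` to `Φ` by the
semilinear map `v ↦ T σ(v)`, at the same point or at the reflected one. Applying this map to the
equations for `Φ` gives those for `Ψ`; applying it (followed by `A ^ (2 m + 1)` in the local cases)
to the columns of `F` and `G` gives those of `F` and `H` up to scalar factors, order and column
operations (`casF_of_local`, `casG_of_local`, `casF_of_nonlocal`, `casG_of_nonlocal`). Hence
`R = δ Q̂`, and the equation for `Q` reduces to the stated one. In the real cases the constraints force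
`|A ^ (2 m + 1) T|` or `|T|` to be a sign, so it may be replaced by its inverse.
-/

noncomputable section

/-! ### Determinants with two blocks of columns -/

/-- The determinant `|u₀, …, u_m; v₀, …, v_m|` of two blocks of `m + 1` columns each. -/
def casoratian (m : ℕ) (u v : ℕ → Fin (2 * m + 2) → ℂ) : ℂ :=
  Matrix.det (Matrix.of fun i j : Fin (2 * m + 2) =>
    (if j.val ≤ m then u j.val else v (j.val - (m + 1))) i)

/-- The positions of the two blocks of columns. -/
def blockEquiv (m : ℕ) : Fin (m + 1) ⊕ Fin (m + 1) ≃ Fin (2 * m + 2) :=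
  finSumFinEquiv.trans (finCongr (by omega))

@[simp] theorem blockEquiv_inl (m : ℕ) (j : Fin (m + 1)) :
    (blockEquiv m (Sum.inl j)).val = j.val := by
  simp [blockEquiv]

@[simp] theorem blockEquiv_inr (m : ℕ) (j : Fin (m + 1)) :
    (blockEquiv m (Sum.inr j)).val = m + 1 + j.val := by
  simp [blockEquiv, add_comm]

/-- The matrix whose determinant is `casoratian m u v`, with columns indexed by the two blocks. -/
def blockCols (m : ℕ) (u v : ℕ → Fin (2 * m + 2) → ℂ) :
    Matrix (Fin (m + 1) ⊕ Fin (m + 1)) (Fin (m + 1) ⊕ Fin (m + 1)) ℂ :=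
  Matrix.of fun i k => Sum.elim (fun j : Fin (m + 1) => u j) (fun j : Fin (m + 1) => v j) k
    (blockEquiv m i)

theorem casoratian_eq_det_blockCols (m : ℕ) (u v : ℕ → Fin (2 * m + 2) → ℂ) :
    casoratian m u v = (blockCols m u v).det := by
  rw [casoratian, ← Matrix.det_submatrix_equiv_self (blockEquiv m)]
  congr 1
  ext i k
  rcases k with j | j
  · have : j.val ≤ m := by omega
    simp [blockCols, this]
  · have : ¬ m + 1 + j.val ≤ m := by omega
    simp [blockCols, this]

section
variable {m : ℕ} {u v u' v' : ℕ → Fin (2 * m + 2) → ℂ}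

theorem casoratian_congr (hu : ∀ j ≤ m, u j = u' j) (hv : ∀ j ≤ m, v j = v' j) :
    casoratian m u v = casoratian m u' v' := by
  rw [casoratian_eq_det_blockCols, casoratian_eq_det_blockCols]
  congr 1
  ext i k
  rcases k with j | j
  · simp [blockCols, hu j (by omega)]
  · simp [blockCols, hv j (by omega)]

/-- The same permutation applied to both blocks has even sign in total. -/
theorem casoratian_perm (e : Equiv.Perm (Fin (m + 1)))
    (hu : ∀ j : Fin (m + 1), u' j = u (e j)) (hv : ∀ j : Fin (m + 1), v' j = v (e j)) :
    casoratian m u' v' = casoratian m u v := by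
  rw [casoratian_eq_det_blockCols, casoratian_eq_det_blockCols]
  have h : blockCols m u' v' = (blockCols m u v).submatrix id (Equiv.Perm.sumCongr e e) := by
    ext i k
    rcases k with j | j
    · simp [blockCols, hu]
    · simp [blockCols, hv]
  rw [h, Matrix.det_permute', Equiv.Perm.sign_sumCongr, Int.units_mul_self]
  simp

theorem casoratian_reverse :
    casoratian m (fun j => u (m - j)) (fun j => v (m - j)) = casoratian m u v := by
  refine casoratian_perm Fin.revPerm (fun j => ?_) (fun j => ?_) <;>
  · simp [Fin.rev]

/-- Moving the first column of each block to its end. -/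
theorem casoratian_rotate :
    casoratian m (fun j => if j = m then u 0 else u (j + 1))
      (fun j => if j = m then v 0 else v (j + 1)) = casoratian m u v := by
  refine casoratian_perm (finRotate (m + 1)) (fun j => ?_) (fun j => ?_) <;>
  · rw [coe_finRotate]
    by_cases h : j = Fin.last m
    · simp [h]
    · have : j.val ≠ m := fun h' => h (Fin.ext h')
      simp [h, this]

theorem casoratian_smul (c d : ℕ → ℂ) :
    casoratian m (fun j => c j • u j) (fun j => d j • v j)
      = (∏ j ∈ Finset.range (m + 1), c j) * (∏ j ∈ Finset.range (m + 1), d j)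
        * casoratian m u v := by
  rw [casoratian_eq_det_blockCols, casoratian_eq_det_blockCols]
  have h := Matrix.det_mul_row
    (Sum.elim (fun j : Fin (m + 1) => c j) (fun j : Fin (m + 1) => d j)) (blockCols m u v)
  rw [Fintype.prod_sum_type] at h
  simp only [Sum.elim_inl, Sum.elim_inr] at h
  rw [Fin.prod_univ_eq_prod_range, Fin.prod_univ_eq_prod_range] at h
  rw [← h]
  congr 1
  ext i k
  rcases k with j | j <;> simp [blockCols]

theorem casoratian_smul_const (c d : ℂ) :
    casoratian m (fun j => c • u j) (fun j => d • v j)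
      = c ^ (m + 1) * d ^ (m + 1) * casoratian m u v := by
  rw [casoratian_smul (fun _ => c) (fun _ => d)]
  simp

theorem casoratian_mulVec (M : Mat m) :
    casoratian m (fun j => M.mulVec (u j)) (fun j => M.mulVec (v j))
      = M.det * casoratian m u v := by
  rw [casoratian, casoratian, ← Matrix.det_mul]
  congr 1
  ext i j
  by_cases h : j.val ≤ m <;> simp [h, Matrix.mul_apply, Matrix.mulVec, dotProduct]

theorem casoratian_map (σ : ℂ →+* ℂ) :
    casoratian m (fun j => σ ∘ u j) (fun j => σ ∘ v j) = σ (casoratian m u v) := by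
  rw [casoratian, casoratian, RingHom.map_det]
  congr 1
  ext i j
  by_cases h : j.val ≤ m <;> simp [h]

/-- Multiples of columns of the second block may be added to the matching columns of the first. -/
theorem casoratian_add_left (c : ℕ → ℂ) :
    casoratian m (fun j => u j + c j • v j) v = casoratian m u v := by
  rw [casoratian_eq_det_blockCols, casoratian_eq_det_blockCols]
  have h : blockCols m (fun j => u j + c j • v j) v = blockCols m u v *
      Matrix.fromBlocks 1 0 (Matrix.diagonal fun j : Fin (m + 1) => c j) 1 := by
    ext i k
    rcases k with j | j
    · simp [blockCols, Matrix.mul_apply, Fintype.sum_sum_type, Matrix.one_apply,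
        Matrix.diagonal_apply, mul_comm]
    · simp [blockCols, Matrix.mul_apply, Fintype.sum_sum_type, Matrix.one_apply]
  rw [h, Matrix.det_mul, Matrix.det_fromBlocks_zero₁₂]
  simp

/-- Multiples of columns of the first block may be added to the matching columns of the second. -/
theorem casoratian_add_right (c : ℕ → ℂ) :
    casoratian m u (fun j => v j + c j • u j) = casoratian m u v := by
  rw [casoratian_eq_det_blockCols, casoratian_eq_det_blockCols]
  have h : blockCols m u (fun j => v j + c j • u j) = blockCols m u v *
      Matrix.fromBlocks 1 (Matrix.diagonal fun j : Fin (m + 1) => c j) 0 1 := by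
    ext i k
    rcases k with j | j
    · simp [blockCols, Matrix.mul_apply, Fintype.sum_sum_type, Matrix.one_apply]
    · simp [blockCols, Matrix.mul_apply, Fintype.sum_sum_type, Matrix.one_apply,
        Matrix.diagonal_apply, mul_comm, add_comm]
  rw [h, Matrix.det_mul, Matrix.det_fromBlocks_zero₂₁]
  simp

/-- Exchanging matching columns of the two blocks at the positions satisfying `p`. -/
theorem casoratian_exchange (p : ℕ → Prop) [DecidablePred p] :
    casoratian m (fun j => if p j then v j else u j) (fun j => if p j then u j else v j)
      = (∏ j ∈ Finset.range (m + 1), if p j then (-1 : ℂ) else 1) * casoratian m u v := by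
  let e : ℕ → ℂ := fun j => if p j then 1 else 0
  -- `(u, v) ↦ (u + v, v) ↦ (u + v, -u) ↦ (v, -u)` at the exchanged positions
  rw [← casoratian_add_left (u := u) e, ← casoratian_add_right (v := v) (fun j => - e j),
    ← casoratian_add_left (u := fun j => u j + e j • v j) e]
  have h := casoratian_smul (m := m) (u := fun j => if p j then v j else u j)
    (v := fun j => if p j then -u j else v j) (fun _ => 1) (fun j => if p j then (-1 : ℂ) else 1)
  simp only [Finset.prod_const_one, one_mul, one_smul] at h
  calc _ = casoratian m (fun j => if p j then v j else u j)
        (fun j => (if p j then (-1 : ℂ) else 1) • (if p j then -u j else v j)) := by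
        congr 1
        funext j
        by_cases hp : p j <;> simp [hp]
    _ = _ := h
    _ = _ := by
        congr 2
        · funext j
          by_cases hp : p j <;> simp [hp, e]
        · funext j
          by_cases hp : p j <;> simp [hp, e]

theorem casoratian_swap : casoratian m v u = (-1) ^ (m + 1) * casoratian m u v := by
  have h := casoratian_exchange (m := m) (u := u) (v := v) (fun _ => True)
  simpa using h

theorem casoratian_exchange_last :
    casoratian m (fun j => if j = m then v j else u j) (fun j => if j = m then u j else v j)
      = - casoratian m u v := by
  rw [casoratian_exchange, Finset.prod_ite_eq' (Finset.range (m + 1)) m (fun _ => (-1 : ℂ))]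
  simp

end

/-! ### Polynomial combinations and Krylov determinants -/

section
open Polynomial

/-- The vector `p(M) a + q(M) b`. -/
def polyComb {m : ℕ} (M : Mat m) (a b : Fin (2 * m + 2) → ℂ) (p q : ℂ[X]) :
    Fin (2 * m + 2) → ℂ :=
  (aeval M p).mulVec a + (aeval M q).mulVec b

variable {m : ℕ} {M : Mat m} {a b : Fin (2 * m + 2) → ℂ}

theorem polyComb_add (p q p' q' : ℂ[X]) :
    polyComb M a b (p + p') (q + q') = polyComb M a b p q + polyComb M a b p' q' := by
  simp only [polyComb, map_add, Matrix.add_mulVec]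
  abel

theorem polyComb_sub (p q p' q' : ℂ[X]) :
    polyComb M a b (p - p') (q - q') = polyComb M a b p q - polyComb M a b p' q' := by
  simp only [polyComb, map_sub, Matrix.sub_mulVec]
  abel

theorem polyComb_mul (l p q : ℂ[X]) :
    polyComb M a b (l * p) (l * q) = (aeval M l).mulVec (polyComb M a b p q) := by
  simp only [polyComb, map_mul, Matrix.mulVec_add, Matrix.mulVec_mulVec]

theorem aeval_mulVec_eq_sum (p : ℂ[X]) {k : ℕ} (hp : p.natDegree ≤ k)
    (v : Fin (2 * m + 2) → ℂ) :
    (aeval M p).mulVec v = ∑ j ∈ Finset.range (k + 1), p.coeff j • (M ^ j).mulVec v := by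
  rw [aeval_eq_sum_range' (Nat.lt_succ_of_le hp), Matrix.sum_mulVec]
  simp only [Matrix.smul_mulVec]

/-- The determinant of the first `m + 1` iterates of `a` and of `b` under `M`. -/
def krylovDet (M : Mat m) (a b : Fin (2 * m + 2) → ℂ) : ℂ :=
  casoratian m (fun j => (M ^ j).mulVec a) (fun j => (M ^ j).mulVec b)

/-- The matrix whose columns are the first `m + 1` iterates of `a` and of `b` under `M`. -/
def krylovMat (M : Mat m) (a b : Fin (2 * m + 2) → ℂ) : Mat m :=
  Matrix.of fun i j : Fin (2 * m + 2) =>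
    (if j.val ≤ m then (M ^ j.val).mulVec a else (M ^ (j.val - (m + 1))).mulVec b) i

theorem det_krylovMat : (krylovMat M a b).det = krylovDet M a b := rfl

theorem krylovMat_mulVec (c : Fin (2 * m + 2) → ℂ) :
    (krylovMat M a b).mulVec c
      = ∑ j : Fin (m + 1), c (blockEquiv m (Sum.inl j)) • (M ^ j.val).mulVec a
        + ∑ j : Fin (m + 1), c (blockEquiv m (Sum.inr j)) • (M ^ j.val).mulVec b := by
  ext i
  rw [Matrix.mulVec, dotProduct, ← (blockEquiv m).sum_comp, Fintype.sum_sum_type]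
  simp only [Pi.add_apply, Finset.sum_apply, Pi.smul_apply, smul_eq_mul]
  congr 1
  · refine Finset.sum_congr rfl fun j _ => ?_
    have : j.val ≤ m := by omega
    simp [krylovMat, this, mul_comm]
  · refine Finset.sum_congr rfl fun j _ => ?_
    have : ¬ m + 1 + j.val ≤ m := by omega
    simp [krylovMat, this, mul_comm]

/-- The coefficient vector of a pair of polynomials along the two blocks; only the coefficients of
degree at most `m` are kept. -/
def pairVec (m : ℕ) (p q : ℂ[X]) : Fin (2 * m + 2) → ℂ := fun i =>
  Sum.elim (fun j : Fin (m + 1) => p.coeff j) (fun j : Fin (m + 1) => q.coeff j)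
    ((blockEquiv m).symm i)

theorem krylovMat_mulVec_pairVec {p q : ℂ[X]} (hp : p.natDegree ≤ m) (hq : q.natDegree ≤ m) :
    (krylovMat M a b).mulVec (pairVec m p q) = polyComb M a b p q := by
  rw [krylovMat_mulVec, polyComb, aeval_mulVec_eq_sum p hp, aeval_mulVec_eq_sum q hq,
    ← Fin.sum_univ_eq_sum_range (fun j => p.coeff j • (M ^ j).mulVec a),
    ← Fin.sum_univ_eq_sum_range (fun j => q.coeff j • (M ^ j).mulVec b)]
  simp [pairVec]

/-- If the iterates are linearly independent, a low-degree relation between them is trivial. -/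
theorem eq_zero_of_polyComb_eq_zero (h : krylovDet M a b ≠ 0) {p q : ℂ[X]}
    (hp : p.natDegree ≤ m) (hq : q.natDegree ≤ m) (hpq : polyComb M a b p q = 0) :
    p = 0 ∧ q = 0 := by
  have hc : pairVec m p q = 0 := by
    apply Matrix.eq_zero_of_mulVec_eq_zero (M := krylovMat M a b) h
    rw [krylovMat_mulVec_pairVec hp hq, hpq]
  constructor
  · ext k
    by_cases hk : k ≤ m
    · have := congrFun hc (blockEquiv m (Sum.inl ⟨k, by omega⟩))
      simpa [pairVec] using this
    · rw [coeff_eq_zero_of_natDegree_lt (by omega), coeff_zero]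
  · ext k
    by_cases hk : k ≤ m
    · have := congrFun hc (blockEquiv m (Sum.inr ⟨k, by omega⟩))
      simpa [pairVec] using this
    · rw [coeff_eq_zero_of_natDegree_lt (by omega), coeff_zero]

theorem det_updateCol_updateCol_one {n : Type*} [Fintype n] [DecidableEq n] {i j : n} (hij : i ≠ j)
    (u v : n → ℂ) :
    (((1 : Matrix n n ℂ).updateCol i u).updateCol j v).det = u i * v j - u j * v i := by
  -- a rank-two perturbation of the identity, to which Sylvester's determinant identity applies
  have h : ((1 : Matrix n n ℂ).updateCol i u).updateCol j v
      = 1 + (Matrix.of fun k (l : Fin 2) => if l = 0 then u k - (1 : Matrix n n ℂ) k i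
          else v k - (1 : Matrix n n ℂ) k j)
        * (Matrix.of fun (l : Fin 2) k => if l = 0 then (1 : Matrix n n ℂ) i k
          else (1 : Matrix n n ℂ) j k) := by
    ext k l
    rw [Matrix.add_apply, Matrix.mul_apply, Fin.sum_univ_two]
    by_cases hj : l = j
    · subst hj
      simp [hij]
    · by_cases hi : l = i
      · subst hi
        simp [hj, Ne.symm hj]
      · simp [hj, hi, Ne.symm hj, Ne.symm hi]
  rw [h, Matrix.det_one_add_mul_comm, Matrix.det_fin_two]
  simp only [Matrix.add_apply, Matrix.mul_apply, Matrix.of_apply, Matrix.one_apply, ite_mul,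
    one_mul, zero_mul]
  simp [hij, Ne.symm hij]
  ring

/-- Cramer's rule for two columns: replacing the columns `a` and `b` multiplies the determinant by
the minor of the coordinates of the new columns. -/
theorem casoratian_replace_heads {p q p' q' : ℂ[X]} (hp : p.natDegree ≤ m) (hq : q.natDegree ≤ m)
    (hp' : p'.natDegree ≤ m) (hq' : q'.natDegree ≤ m) :
    casoratian m (fun j => if j = 0 then polyComb M a b p q else (M ^ j).mulVec a)
      (fun j => if j = 0 then polyComb M a b p' q' else (M ^ j).mulVec b)
      = (p.coeff 0 * q'.coeff 0 - q.coeff 0 * p'.coeff 0) * krylovDet M a b := by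
  have hne : blockEquiv m (Sum.inl 0) ≠ blockEquiv m (Sum.inr 0) := by simp
  have key := det_updateCol_updateCol_one hne (pairVec m p q) (pairVec m p' q')
  have h : (krylovMat M a b) * (((1 : Mat m).updateCol (blockEquiv m (Sum.inl 0))
      (pairVec m p q)).updateCol (blockEquiv m (Sum.inr 0)) (pairVec m p' q'))
      = Matrix.of fun i j : Fin (2 * m + 2) =>
    (if j.val ≤ m then (if j.val = 0 then polyComb M a b p q else (M ^ j.val).mulVec a)
      else (if j.val - (m + 1) = 0 then polyComb M a b p' q'
        else (M ^ (j.val - (m + 1))).mulVec b)) i := by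
    ext i j
    obtain ⟨j, rfl⟩ := (blockEquiv m).surjective j
    rw [Matrix.mul_updateCol, Matrix.mul_updateCol, krylovMat_mulVec_pairVec hp hq,
      krylovMat_mulVec_pairVec hp' hq', Matrix.mul_one]
    rcases j with j | j
    · have h1 : j.val ≤ m := by omega
      by_cases hj : j = 0
      · subst hj
        simp [-Fin.val_eq_zero_iff]
      · have h2 : j.val ≠ 0 := fun h => hj (Fin.ext h)
        simp [hj, h1, h2, krylovMat, -Fin.val_eq_zero_iff]
    · have h1 : ¬ m + 1 + j.val ≤ m := by omega
      by_cases hj : j = 0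
      · subst hj
        simp
      · have h2 : j.val ≠ 0 := fun h => hj (Fin.ext h)
        simp [hj, h1, h2, krylovMat, -Fin.val_eq_zero_iff]
  rw [casoratian, ← h, Matrix.det_mul, key, det_krylovMat]
  simp only [pairVec, Equiv.symm_apply_apply, Sum.elim_inl, Sum.elim_inr, Fin.val_zero]
  ring
end

/-! ### The Darboux relation and division by it -/

section
open Polynomial

/-- The two relations `M^{m+1} a = x(M) a + y(M) b` and `M^{m+1} b = z(M) a + w(M) b` with
polynomials of degree at most `m`: the rows of a monic `2 × 2` matrix polynomial
of degree `m + 1` that annihilates the pair `(a, b)`. -/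
structure DarbouxRelation {m : ℕ} (M : Mat m) (a b : Fin (2 * m + 2) → ℂ) (x y z w : ℂ[X]) :
    Prop where
  natDegree_x : x.natDegree ≤ m
  natDegree_y : y.natDegree ≤ m
  natDegree_z : z.natDegree ≤ m
  natDegree_w : w.natDegree ≤ m
  first : polyComb M a b (X ^ (m + 1) - x) (-y) = 0
  second : polyComb M a b (-z) (X ^ (m + 1) - w) = 0

namespace DarbouxRelation
variable {m : ℕ} {M : Mat m} {a b : Fin (2 * m + 2) → ℂ} {x y z w : ℂ[X]}

theorem coeff_x (D : DarbouxRelation M a b x y z w) {k : ℕ} (hk : m < k) : x.coeff k = 0 :=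
  coeff_eq_zero_of_natDegree_lt (D.natDegree_x.trans_lt hk)

theorem coeff_y (D : DarbouxRelation M a b x y z w) {k : ℕ} (hk : m < k) : y.coeff k = 0 :=
  coeff_eq_zero_of_natDegree_lt (D.natDegree_y.trans_lt hk)

theorem coeff_z (D : DarbouxRelation M a b x y z w) {k : ℕ} (hk : m < k) : z.coeff k = 0 :=
  coeff_eq_zero_of_natDegree_lt (D.natDegree_z.trans_lt hk)

theorem coeff_w (D : DarbouxRelation M a b x y z w) {k : ℕ} (hk : m < k) : w.coeff k = 0 :=
  coeff_eq_zero_of_natDegree_lt (D.natDegree_w.trans_lt hk)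

/-- One step of the division of a relation by the two basic relations: since these are monic,
subtracting multiples by `X ^ k` removes the coefficients of degree `m + 1 + k`. -/
theorem exists_reduce (D : DarbouxRelation M a b x y z w) (k : ℕ) {p q : ℂ[X]}
    (hp : p.natDegree ≤ m + (k + 1)) (hq : q.natDegree ≤ m + (k + 1))
    (hpq : polyComb M a b p q = 0) :
    ∃ c d : ℂ, ∃ p' q' : ℂ[X], p'.natDegree ≤ m + k ∧ q'.natDegree ≤ m + k ∧
      polyComb M a b p' q' = 0 ∧
      p = C c * X ^ k * (X ^ (m + 1) - x) + C d * X ^ k * (-z) + p' ∧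
      q = C c * X ^ k * (-y) + C d * X ^ k * (X ^ (m + 1) - w) + q' := by
  refine ⟨p.coeff (m + 1 + k), q.coeff (m + 1 + k),
    p - (C (p.coeff (m + 1 + k)) * X ^ k * (X ^ (m + 1) - x)
      + C (q.coeff (m + 1 + k)) * X ^ k * (-z)),
    q - (C (p.coeff (m + 1 + k)) * X ^ k * (-y)
      + C (q.coeff (m + 1 + k)) * X ^ k * (X ^ (m + 1) - w)), ?_, ?_, ?_, by ring, by ring⟩
  · rw [natDegree_le_iff_coeff_eq_zero]
    intro N hN
    obtain ⟨i, rfl⟩ : ∃ i, N = (m + 1 + i) + k := ⟨N - (m + 1 + k), by omega⟩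
    simp only [coeff_sub, coeff_add, mul_assoc, coeff_C_mul, coeff_X_pow_mul, coeff_neg,
      coeff_X_pow]
    rw [D.coeff_x (by omega), D.coeff_z (by omega)]
    rcases i with _ | i
    · simp
    · rw [coeff_eq_zero_of_natDegree_lt (p := p) (n := m + 1 + (i + 1) + k) (by omega)]
      simp
  · rw [natDegree_le_iff_coeff_eq_zero]
    intro N hN
    obtain ⟨i, rfl⟩ : ∃ i, N = (m + 1 + i) + k := ⟨N - (m + 1 + k), by omega⟩
    simp only [coeff_sub, coeff_add, mul_assoc, coeff_C_mul, coeff_X_pow_mul, coeff_neg,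
      coeff_X_pow]
    rw [D.coeff_y (by omega), D.coeff_w (by omega)]
    rcases i with _ | i
    · simp
    · rw [coeff_eq_zero_of_natDegree_lt (p := q) (n := m + 1 + (i + 1) + k) (by omega)]
      simp
  · rw [polyComb_sub, hpq, polyComb_add, polyComb_mul, polyComb_mul, D.first, D.second]
    simp

/-- If the Krylov vectors are independent, every relation of degree at most `m + 1` is a constant
combination of the two basic ones. -/
theorem reduce_one (D : DarbouxRelation M a b x y z w) (h : krylovDet M a b ≠ 0) {p q : ℂ[X]}
    (hp : p.natDegree ≤ m + 1) (hq : q.natDegree ≤ m + 1) (hpq : polyComb M a b p q = 0) :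
    ∃ c d : ℂ, p = C c * (X ^ (m + 1) - x) + C d * (-z) ∧
      q = C c * (-y) + C d * (X ^ (m + 1) - w) := by
  obtain ⟨c, d, p', q', hp', hq', h', rfl, rfl⟩ := D.exists_reduce 0 hp hq hpq
  obtain ⟨rfl, rfl⟩ := eq_zero_of_polyComb_eq_zero h hp' hq' h'
  exact ⟨c, d, by simp, by simp⟩

/-- The division of a relation of degree at most `m + 2`. -/
theorem reduce_two (D : DarbouxRelation M a b x y z w) (h : krylovDet M a b ≠ 0) {p q : ℂ[X]}
    (hp : p.natDegree ≤ m + 2) (hq : q.natDegree ≤ m + 2) (hpq : polyComb M a b p q = 0) :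
    ∃ c₁ d₁ c₀ d₀ : ℂ,
      p = (C c₁ * X + C c₀) * (X ^ (m + 1) - x) + (C d₁ * X + C d₀) * (-z) ∧
      q = (C c₁ * X + C c₀) * (-y) + (C d₁ * X + C d₀) * (X ^ (m + 1) - w) := by
  obtain ⟨c₁, d₁, p', q', hp', hq', h', rfl, rfl⟩ := D.exists_reduce 1 hp hq hpq
  obtain ⟨c₀, d₀, rfl, rfl⟩ := D.reduce_one h hp' hq' h'
  exact ⟨c₁, d₁, c₀, d₀, by ring, by ring⟩

/-- The division of a relation of degree at most `m + 3`. -/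
theorem reduce_three (D : DarbouxRelation M a b x y z w) (h : krylovDet M a b ≠ 0) {p q : ℂ[X]}
    (hp : p.natDegree ≤ m + 3) (hq : q.natDegree ≤ m + 3) (hpq : polyComb M a b p q = 0) :
    ∃ c₂ d₂ c₁ d₁ c₀ d₀ : ℂ,
      p = (C c₂ * X ^ 2 + C c₁ * X + C c₀) * (X ^ (m + 1) - x)
        + (C d₂ * X ^ 2 + C d₁ * X + C d₀) * (-z) ∧
      q = (C c₂ * X ^ 2 + C c₁ * X + C c₀) * (-y)
        + (C d₂ * X ^ 2 + C d₁ * X + C d₀) * (X ^ (m + 1) - w) := by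
  obtain ⟨c₂, d₂, p', q', hp', hq', h', rfl, rfl⟩ := D.exists_reduce 2 hp hq hpq
  obtain ⟨c₁, d₁, c₀, d₀, rfl, rfl⟩ := D.reduce_two h hp' hq' h'
  exact ⟨c₂, d₂, c₁, d₁, c₀, d₀, by ring, by ring⟩

end DarbouxRelation

end

/-! ### The lattice shift of the Darboux coefficients -/

section
open Polynomial
namespace DarbouxRelation
variable {m : ℕ} {M : Mat m} {a b a' b' : Fin (2 * m + 2) → ℂ}
  {x y z w x' y' z' w' : ℂ[X]}

/-- The lattice shift of the Darboux coefficients, with `q`, `r` the background at the site of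
`(a, b)` and primes at the next site. By `htr` both basic relations at the next site pull back to
relations of low degree at the present one, which are combinations of the two basic relations
there; the identities result from comparing extreme coefficients and eliminating the multipliers.
The first two give the lowest coefficients at the next site through those at the present one, the
third gives the numerator of `Q` at the present site through coefficients at the next one. -/
theorem shift (D : DarbouxRelation M a b x y z w) (h : krylovDet M a b ≠ 0)
    (D' : DarbouxRelation M a' b' x' y' z' w') (q r : ℂ)
    (htr : ∀ f g : ℂ[X], polyComb M a' b' f g = 0 →
      polyComb M a b (X * f + C r * g) (C q * (X * f) + g) = 0)
    (hdet : x.coeff 0 * w.coeff 0 - y.coeff 0 * z.coeff 0 ≠ 0) :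
    w'.coeff 0 * (x.coeff 0 - r * y.coeff 0 - q * (r * w.coeff 0 - z.coeff 0))
        = (x.coeff 0 * w.coeff 0 - y.coeff 0 * z.coeff 0) * (1 - q * r) ∧
    y'.coeff 0 * (x.coeff 0 - r * y.coeff 0 - q * (r * w.coeff 0 - z.coeff 0))
        = (x.coeff 0 * w.coeff 0 - y.coeff 0 * z.coeff 0)
          * (y.coeff m + q * w.coeff m - q * x.coeff m - q ^ 2 * z.coeff m) ∧
    w'.coeff 0 * (y.coeff 0 + q * w.coeff 0)
        = q * (x'.coeff 0 * w'.coeff 0 - y'.coeff 0 * z'.coeff 0) + w'.coeff 0 * y'.coeff 1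
          + y'.coeff 0 * (X ^ (m + 1) - w').coeff 1 := by
  obtain ⟨c₁, d₁, c₀, d₀, hP, hS⟩ := D.reduce_two h
    (natDegree_le_iff_coeff_eq_zero.2 fun N hN => by
      obtain ⟨i, rfl⟩ : ∃ i, N = (m + 2 + i) + 1 := ⟨N - (m + 3), by omega⟩
      simp only [coeff_add, coeff_X_mul, coeff_C_mul, coeff_sub, coeff_neg, coeff_X_pow]
      rw [D'.coeff_x (by omega), D'.coeff_y (by omega), if_neg (by omega)]
      simp)
    (natDegree_le_iff_coeff_eq_zero.2 fun N hN => by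
      obtain ⟨i, rfl⟩ : ∃ i, N = (m + 2 + i) + 1 := ⟨N - (m + 3), by omega⟩
      simp only [coeff_add, coeff_X_mul, coeff_C_mul, coeff_sub, coeff_neg, coeff_X_pow]
      rw [D'.coeff_x (by omega), D'.coeff_y (by omega), if_neg (by omega)]
      simp)
    (htr _ _ D'.first)
  obtain ⟨c, d, hP', hS'⟩ := D.reduce_one h
    (natDegree_le_iff_coeff_eq_zero.2 fun N hN => by
      obtain ⟨i, rfl⟩ : ∃ i, N = (m + 1 + i) + 1 := ⟨N - (m + 2), by omega⟩
      simp only [coeff_add, coeff_X_mul, coeff_C_mul, coeff_sub, coeff_neg, coeff_X_pow]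
      rw [D'.coeff_z (by omega), D'.coeff_w (by omega), if_neg (by omega)]
      simp)
    (natDegree_le_iff_coeff_eq_zero.2 fun N hN => by
      obtain ⟨i, rfl⟩ : ∃ i, N = (m + 1 + i) + 1 := ⟨N - (m + 2), by omega⟩
      simp only [coeff_add, coeff_X_mul, coeff_C_mul, coeff_sub, coeff_neg, coeff_X_pow]
      rw [D'.coeff_z (by omega), D'.coeff_w (by omega), if_neg (by omega)]
      simp)
    (htr _ _ D'.second)
  have hx := D.coeff_x (Nat.lt_succ_self m)
  have hy := D.coeff_y (Nat.lt_succ_self m)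
  have hz := D.coeff_z (Nat.lt_succ_self m)
  have hw := D.coeff_w (Nat.lt_succ_self m)
  have hx2 := D.coeff_x (show m < m + 1 + 1 by omega)
  have hy2 := D.coeff_y (show m < m + 1 + 1 by omega)
  have hz2 := D.coeff_z (show m < m + 1 + 1 by omega)
  have hw2 := D.coeff_w (show m < m + 1 + 1 by omega)
  have hx' := D'.coeff_x (Nat.lt_succ_self m)
  have hy' := D'.coeff_y (Nat.lt_succ_self m)
  have hw' := D'.coeff_w (Nat.lt_succ_self m)
  have hy2' := D'.coeff_y (show m < m + 1 + 1 by omega)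
  have hm2 : m + 1 + 1 ≠ m + 1 := by omega
  -- coefficients of degree `m + 2`, `m + 1`, `0` and `1` in the pull-back of the first relation
  have t1 := congrArg (fun f => coeff f (m + 1 + 1)) hP
  have t2 := congrArg (fun f => coeff f (m + 1 + 1)) hS
  have t3 := congrArg (fun f => coeff f (m + 1)) hP
  have t4 := congrArg (fun f => coeff f (m + 1)) hS
  have t5 := congrArg (fun f => coeff f 0) hP
  have t6 := congrArg (fun f => coeff f 0) hS
  have t7 := congrArg (fun f => coeff f (0 + 1)) hS
  -- coefficients of degree `m + 1`, `0` and `1` in the pull-back of the second relation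
  have s3 := congrArg (fun f => coeff f (m + 1)) hP'
  have s4 := congrArg (fun f => coeff f (m + 1)) hS'
  have s5 := congrArg (fun f => coeff f 0) hP'
  have s6 := congrArg (fun f => coeff f 0) hS'
  have s7 := congrArg (fun f => coeff f (0 + 1)) hS'
  have hm1 : m ≠ m + 1 := by omega
  have hm0 : 0 ≠ m + 1 := by omega
  simp only [add_mul, mul_assoc, coeff_add, coeff_X_mul, coeff_C_mul, coeff_sub, coeff_neg,
    coeff_X_pow, mul_coeff_zero, coeff_X_zero, coeff_C_zero, hx, hy, hz, hw, hx2, hy2, hz2, hw2,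
    hx', hy', hw', hy2', hm2, hm1, hm0, if_true, if_false]
    at t1 t2 t3 t4 t5 t6 t7 s3 s4 s5 s6 s7
  rw [coeff_sub, coeff_X_pow]
  have ec : c = r - z'.coeff m := by linear_combination -s3
  have ed : d = 1 - q * z'.coeff m := by linear_combination -s4
  obtain rfl : c₁ = 1 := by linear_combination -t1
  have hd₁ : d₁ = q := by linear_combination -t2
  rw [hd₁] at t3 t4 t7
  have e5 : c * x.coeff 0 + d * z.coeff 0 = r * w'.coeff 0 := by linear_combination s5
  have e6 : c * y.coeff 0 + d * w.coeff 0 = w'.coeff 0 := by linear_combination s6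
  have g5 : c₀ * x.coeff 0 + d₀ * z.coeff 0 = r * y'.coeff 0 := by linear_combination t5
  have g6 : c₀ * y.coeff 0 + d₀ * w.coeff 0 = y'.coeff 0 := by linear_combination t6
  set Δ := x.coeff 0 * w.coeff 0 - y.coeff 0 * z.coeff 0 with hΔ
  have f1 : w'.coeff 0 * (r * w.coeff 0 - z.coeff 0) = Δ * c := by
    linear_combination -w.coeff 0 * e5 + z.coeff 0 * e6
  have f2 : w'.coeff 0 * (x.coeff 0 - r * y.coeff 0) = Δ * d := by
    linear_combination -x.coeff 0 * e6 + y.coeff 0 * e5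
  have k1 : y'.coeff 0 * (r * w.coeff 0 - z.coeff 0) = Δ * c₀ := by
    linear_combination -w.coeff 0 * g5 + z.coeff 0 * g6
  have k2 : y'.coeff 0 * (x.coeff 0 - r * y.coeff 0) = Δ * d₀ := by
    linear_combination -x.coeff 0 * g6 + y.coeff 0 * g5
  -- the multipliers `(c₀, d₀)` and `(c, d)` are proportional, as `f1`, `f2`, `k1`, `k2` show
  have hc : w'.coeff 0 * c₀ = y'.coeff 0 * c :=
    mul_left_cancel₀ hdet (by linear_combination y'.coeff 0 * f1 - w'.coeff 0 * k1)
  have hd : w'.coeff 0 * d₀ = y'.coeff 0 * d :=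
    mul_left_cancel₀ hdet (by linear_combination y'.coeff 0 * f2 - w'.coeff 0 * k2)
  -- the coefficient of degree `1` in the monic entry is an `if`, because `m` may be `0`
  refine ⟨by linear_combination f2 - q * f1 + Δ * ed - q * Δ * ec, ?_, ?_⟩
  · linear_combination k2 - q * k1 + Δ * (q * t3 - t4)
  · linear_combination w'.coeff 0 * t7 - y'.coeff 0 * s7 - y.coeff 1 * hc
      + ((if 0 + 1 = m + 1 then (1 : ℂ) else 0) - w.coeff 1) * hd

end DarbouxRelation
end

/-! ### The time evolution of the Darboux coefficients -/

section
open Polynomial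
namespace DarbouxRelation
variable {m : ℕ} {M : Mat m} {a b : Fin (2 * m + 2) → ℂ} {x y z w x' y' z' w' : ℂ[X]}

/-- The degree of the entries of a differentiated relation, which is the relation with
differentiated coefficients plus multiples of its entries by the quadratic polynomials of the time
evolution, everything multiplied by `X`. -/
theorem natDegree_time_le {f g h : ℂ[X]} (hf : f.natDegree ≤ m + 1) (hg : g.natDegree ≤ m + 1)
    (hh : h.natDegree ≤ m + 1) (c₂ c₁ c₀ d₂ d₁ d₀ : ℂ) :
    (X * f + (C c₂ * (X * (X * g)) + C c₁ * (X * g) + C c₀ * g)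
      + (C d₂ * (X * (X * h)) + C d₁ * (X * h) + C d₀ * h)).natDegree ≤ m + 3 := by
  rw [natDegree_le_iff_coeff_eq_zero]
  intro N hN
  obtain ⟨i, rfl⟩ : ∃ i, N = (m + 2 + i) + 1 + 1 := ⟨N - (m + 4), by omega⟩
  simp only [coeff_add, coeff_X_mul, coeff_C_mul]
  rw [coeff_eq_zero_of_natDegree_lt (p := f) (by omega),
    coeff_eq_zero_of_natDegree_lt (p := g) (n := m + 2 + i) (by omega),
    coeff_eq_zero_of_natDegree_lt (p := g) (n := m + 2 + i + 1) (by omega),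
    coeff_eq_zero_of_natDegree_lt (p := g) (n := m + 2 + i + 1 + 1) (by omega),
    coeff_eq_zero_of_natDegree_lt (p := h) (n := m + 2 + i) (by omega),
    coeff_eq_zero_of_natDegree_lt (p := h) (n := m + 2 + i + 1) (by omega),
    coeff_eq_zero_of_natDegree_lt (p := h) (n := m + 2 + i + 1 + 1) (by omega)]
  simp

theorem natDegree_first_left (D : DarbouxRelation M a b x y z w) :
    (X ^ (m + 1) - x).natDegree ≤ m + 1 :=
  (natDegree_sub_le _ _).trans (max_le (natDegree_X_pow_le _) (D.natDegree_x.trans (by omega)))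

theorem natDegree_first_right (D : DarbouxRelation M a b x y z w) : (-y).natDegree ≤ m + 1 := by
  rw [natDegree_neg]
  exact D.natDegree_y.trans (by omega)

theorem natDegree_second_left (D : DarbouxRelation M a b x y z w) : (-z).natDegree ≤ m + 1 := by
  rw [natDegree_neg]
  exact D.natDegree_z.trans (by omega)

theorem natDegree_second_right (D : DarbouxRelation M a b x y z w) :
    (X ^ (m + 1) - w).natDegree ≤ m + 1 :=
  (natDegree_sub_le _ _).trans (max_le (natDegree_X_pow_le _) (D.natDegree_w.trans (by omega)))

/-- The time derivative of the combination `y₀ + q w₀` of lowest Darboux coefficients. The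
hypotheses `h₁`, `h₂` are the time derivatives of the two basic relations, multiplied by `M`; they
are again relations, hence combinations of the basic ones, and comparing the two top and the two
bottom coefficients determines the multipliers and the derivatives of the lowest coefficients.
`Qm` stands for the value of `y₀ + q w₀` at the previous site, which `hQ` expresses through the
coefficients at the present one. -/
theorem evolve (D : DarbouxRelation M a b x y z w) (h : krylovDet M a b ≠ 0)
    (hx' : x'.natDegree ≤ m) (hy' : y'.natDegree ≤ m) (hz' : z'.natDegree ≤ m)
    (hw' : w'.natDegree ≤ m) (q r qm rm κ Qm : ℂ) (hκ : κ = r * qm - q * rm)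
    (h₁ : polyComb M a b
      (X * -x' + (C (1 / 2) * (X * (X * (X ^ (m + 1) - x))) + C (κ / 2) * (X * (X ^ (m + 1) - x))
          + C (-1 / 2) * (X ^ (m + 1) - x))
        + (C 0 * (X * (X * -y)) + C rm * (X * -y) + C r * -y))
      (X * -y' + (C q * (X * (X * (X ^ (m + 1) - x))) + C qm * (X * (X ^ (m + 1) - x))
          + C 0 * (X ^ (m + 1) - x))
        + (C (-1 / 2) * (X * (X * -y)) + C (-κ / 2) * (X * -y) + C (1 / 2) * -y)) = 0)
    (h₂ : polyComb M a b
      (X * -z' + (C (1 / 2) * (X * (X * -z)) + C (κ / 2) * (X * -z) + C (-1 / 2) * -z)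
        + (C 0 * (X * (X * (X ^ (m + 1) - w))) + C rm * (X * (X ^ (m + 1) - w))
          + C r * (X ^ (m + 1) - w)))
      (X * -w' + (C q * (X * (X * -z)) + C qm * (X * -z) + C 0 * -z)
        + (C (-1 / 2) * (X * (X * (X ^ (m + 1) - w))) + C (-κ / 2) * (X * (X ^ (m + 1) - w))
          + C (1 / 2) * (X ^ (m + 1) - w))) = 0)
    (hQ : w.coeff 0 * Qm = qm * (x.coeff 0 * w.coeff 0 - y.coeff 0 * z.coeff 0)
      + w.coeff 0 * y.coeff 1 + y.coeff 0 * (X ^ (m + 1) - w).coeff 1) :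
    (x.coeff 0 * w.coeff 0 - y.coeff 0 * z.coeff 0) * (y'.coeff 0 + q * w'.coeff 0)
      = w.coeff 0 * (x.coeff 0 * w.coeff 0 - y.coeff 0 * z.coeff 0)
          * (qm * (1 - q * r) + y.coeff m + q * w.coeff m - q * x.coeff m - q ^ 2 * z.coeff m)
        - (x.coeff 0 * w.coeff 0 - y.coeff 0 * z.coeff 0
            - (y.coeff 0 + q * w.coeff 0) * (r * w.coeff 0 - z.coeff 0)) * Qm := by
  have neg_le : ∀ {f : ℂ[X]}, f.natDegree ≤ m → (-f).natDegree ≤ m + 1 := fun {f} hf => by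
    rw [natDegree_neg]; omega
  obtain ⟨c₂, d₂, c₁, d₁, c₀, d₀, hP, hS⟩ := D.reduce_three h
    (natDegree_time_le (neg_le hx') D.natDegree_first_left D.natDegree_first_right _ _ _ _ _ _)
    (natDegree_time_le (neg_le hy') D.natDegree_first_left D.natDegree_first_right _ _ _ _ _ _) h₁
  obtain ⟨γ₂, δ₂, γ₁, δ₁, γ₀, δ₀, hP', hS'⟩ := D.reduce_three h
    (natDegree_time_le (neg_le hz') D.natDegree_second_left D.natDegree_second_right _ _ _ _ _ _)
    (natDegree_time_le (neg_le hw') D.natDegree_second_left D.natDegree_second_right _ _ _ _ _ _)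
    h₂
  have top : ∀ {f : ℂ[X]}, f.natDegree ≤ m → f.coeff (m + 1) = 0 ∧ f.coeff (m + 1 + 1) = 0 ∧
      f.coeff (m + 1 + 1 + 1) = 0 := fun hf =>
    ⟨coeff_eq_zero_of_natDegree_lt (by omega), coeff_eq_zero_of_natDegree_lt (by omega),
      coeff_eq_zero_of_natDegree_lt (by omega)⟩
  have hm0 : 0 ≠ m + 1 := by omega
  have hm1 : m ≠ m + 1 := by omega
  have hm2 : m + 1 + 1 ≠ m + 1 := by omega
  have hm3 : m + 1 + 1 + 1 ≠ m + 1 := by omega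
  have t1 := congrArg (fun f => coeff f (m + 1 + 1 + 1)) hP
  have t2 := congrArg (fun f => coeff f (m + 1 + 1 + 1)) hS
  have t3 := congrArg (fun f => coeff f (m + 1 + 1)) hP
  have t4 := congrArg (fun f => coeff f (m + 1 + 1)) hS
  have t5 := congrArg (fun f => coeff f 0) hP
  have t6 := congrArg (fun f => coeff f 0) hS
  have t7 := congrArg (fun f => coeff f (0 + 1)) hS
  have s1 := congrArg (fun f => coeff f (m + 1 + 1 + 1)) hP'
  have s2 := congrArg (fun f => coeff f (m + 1 + 1 + 1)) hS'
  have s3 := congrArg (fun f => coeff f (m + 1 + 1)) hP'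
  have s4 := congrArg (fun f => coeff f (m + 1 + 1)) hS'
  have s5 := congrArg (fun f => coeff f 0) hP'
  have s6 := congrArg (fun f => coeff f 0) hS'
  have s7 := congrArg (fun f => coeff f (0 + 1)) hS'
  simp only [pow_two, add_mul, mul_assoc, coeff_add, coeff_X_mul, coeff_C_mul, coeff_sub,
    coeff_neg, coeff_X_pow, mul_coeff_zero, coeff_X_zero, coeff_C_zero, top D.natDegree_x,
    top D.natDegree_y, top D.natDegree_z, top D.natDegree_w, top hx', top hy', top hz', top hw',
    hm0, hm1, hm2, hm3, if_true, if_false, zero_add]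
    at t1 t2 t3 t4 t5 t6 t7 s1 s2 s3 s4 s5 s6 s7
  rw [coeff_sub, coeff_X_pow] at hQ
  have hc₂ : c₂ = 1 / 2 := by linear_combination -t1
  have hd₂ : d₂ = q := by linear_combination -t2
  have hγ₂ : γ₂ = 0 := by linear_combination -s1
  have hδ₂ : δ₂ = -1 / 2 := by linear_combination -s2
  rw [hc₂, hd₂] at t3 t4
  rw [hγ₂, hδ₂] at s3 s4
  have hc₁ : c₁ = κ / 2 + q * z.coeff m := by linear_combination -t3
  have hd₁ : d₁ = qm - q * x.coeff m + y.coeff m + q * w.coeff m := by linear_combination -t4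
  have hγ₁ : γ₁ = rm - z.coeff m := by linear_combination -s3
  have hδ₁ : δ₁ = -κ / 2 - q * z.coeff m := by linear_combination -s4
  have e5 : c₀ * x.coeff 0 + d₀ * z.coeff 0 = -(1 / 2) * x.coeff 0 + r * y.coeff 0 := by
    linear_combination t5
  have e6 : c₀ * y.coeff 0 + d₀ * w.coeff 0 = 1 / 2 * y.coeff 0 := by linear_combination t6
  have g5 : γ₀ * x.coeff 0 + δ₀ * z.coeff 0 = -(1 / 2) * z.coeff 0 + r * w.coeff 0 := by
    linear_combination s5
  have g6 : γ₀ * y.coeff 0 + δ₀ * w.coeff 0 = 1 / 2 * w.coeff 0 := by linear_combination s6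
  set ω : ℂ := (if 1 = m + 1 then 1 else 0) - w.coeff 1 with hω
  have hy : y'.coeff 0 = -x.coeff 0 * qm - 1 / 2 * y.coeff 1 + κ / 2 * y.coeff 0
      + c₁ * y.coeff 0 + c₀ * y.coeff 1 + d₁ * w.coeff 0 - d₀ * ω := by
    linear_combination -t7
  have hw : w'.coeff 0 = -z.coeff 0 * qm + 1 / 2 * ω + κ / 2 * w.coeff 0
      + γ₁ * y.coeff 0 + γ₀ * y.coeff 1 + δ₁ * w.coeff 0 - δ₀ * ω := by
    linear_combination -s7
  set Δ := x.coeff 0 * w.coeff 0 - y.coeff 0 * z.coeff 0 with hΔ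
  have kc : Δ * c₀ = w.coeff 0 * (-(1 / 2) * x.coeff 0 + r * y.coeff 0)
      - z.coeff 0 * (1 / 2 * y.coeff 0) := by
    linear_combination w.coeff 0 * e5 - z.coeff 0 * e6
  have kd : Δ * d₀ = x.coeff 0 * (1 / 2 * y.coeff 0)
      - y.coeff 0 * (-(1 / 2) * x.coeff 0 + r * y.coeff 0) := by
    linear_combination x.coeff 0 * e6 - y.coeff 0 * e5
  have kγ : Δ * γ₀ = w.coeff 0 * (-(1 / 2) * z.coeff 0 + r * w.coeff 0)
      - z.coeff 0 * (1 / 2 * w.coeff 0) := by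
    linear_combination w.coeff 0 * g5 - z.coeff 0 * g6
  have kδ : Δ * δ₀ = x.coeff 0 * (1 / 2 * w.coeff 0)
      - y.coeff 0 * (-(1 / 2) * z.coeff 0 + r * w.coeff 0) := by
    linear_combination x.coeff 0 * g6 - y.coeff 0 * g5
  linear_combination Δ * hy + q * Δ * hw + Δ * y.coeff 0 * hc₁ + Δ * w.coeff 0 * hd₁
    + q * Δ * y.coeff 0 * hγ₁ + q * Δ * w.coeff 0 * hδ₁ + y.coeff 1 * kc - ω * kd
    + q * y.coeff 1 * kγ - q * ω * kδ + Δ * y.coeff 0 * hκ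
    + (x.coeff 0 - r * y.coeff 0 - q * (r * w.coeff 0 - z.coeff 0)) * hQ

end DarbouxRelation
end

/-! ### The determinants `F`, `G`, `H` as Darboux coefficients -/

section
open Polynomial
variable {m : ℕ}

theorem casF_eq_casoratian (A : Mat m) (s : Field1) (Φ Ψ : VecField m) (n : ℤ) (t : ℝ) :
    casF A s Φ Ψ n t = s n t ^ (m + 1) *
      casoratian m (fun j => (A ^ (2 * j)).mulVec (Φ (n + 1) t))
        (fun j => (A ^ (2 * j)).mulVec (Ψ n t)) := rfl

/-- The blocks of `G` have `m + 2` and `m` columns; the last column of the first block is counted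
as the first column of the second. -/
theorem casG_eq_casoratian (A : Mat m) (s : Field1) (Φ Ψ : VecField m) (n : ℤ) (t : ℝ) :
    casG A s Φ Ψ n t = s n t ^ (m + 1) *
      casoratian m
        (fun j => if j = 0 then Φ n t else (A ^ (2 * j - 1)).mulVec (Φ (n + 1) t))
        (fun j => if j = 0 then (A ^ (2 * m + 1)).mulVec (Φ (n + 1) t)
          else (A ^ (2 * j - 1)).mulVec (Ψ n t)) := by
  rw [casG, casoratian]
  congr 2
  ext i j
  simp only [Matrix.of_apply]
  by_cases h0 : j.val = 0
  · simp [h0]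
  by_cases h1 : j.val ≤ m
  · rw [if_neg h0, if_pos (by omega), if_pos h1, if_neg h0]
  by_cases h2 : j.val = m + 1
  · rw [if_neg h0, if_pos (by omega), if_neg h1, if_pos (by omega), h2]
    rfl
  · rw [if_neg h0, if_neg (by omega), if_neg h1, if_neg (by omega)]
    congr 2
    omega

/-- The blocks of `H` have `m` and `m + 2` columns; the first column of the second block is counted
as the last column of the first. -/
theorem casH_eq_casoratian (A : Mat m) (s : Field1) (Φ Ψ : VecField m) (n : ℤ) (t : ℝ) :
    casH A s Φ Ψ n t = s n t ^ (m + 1) *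
      casoratian m
        (fun j => if j = m then Ψ (n + 1) t else (A ^ (2 * j + 1)).mulVec (Φ (n + 1) t))
        (fun j => (A ^ (2 * j + 1)).mulVec (Ψ n t)) := by
  rw [casH, casoratian]
  congr 2
  ext i j
  simp only [Matrix.of_apply]
  by_cases h1 : j.val < m
  · rw [if_pos h1, if_pos h1.le, if_neg h1.ne]
  by_cases h2 : j.val = m
  · rw [if_neg h1, if_pos h2, if_pos h2.le, if_pos h2]
  · rw [if_neg h1, if_neg h2, if_neg (by omega)]

theorem casoratian_mul_left (c : ℂ) (u v : ℕ → Fin (2 * m + 2) → ℂ) :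
    c ^ (m + 1) * casoratian m u v = casoratian m (fun j => c • u j) v := by
  have h := casoratian_smul_const (u := u) (v := v) c 1
  simpa using h.symm

section
variable {A : Mat m} {s q r : Field1} {Φ Ψ : VecField m} {n : ℤ} {t : ℝ}

theorem IsSqrtAlpha.ne_zero (hs : IsSqrtAlpha q r s) (n : ℤ) (t : ℝ) : s n t ≠ 0 := by
  intro h
  apply hs.alpha_ne_zero n t
  rw [← hs.sq_eq, h]
  simp

/-- The space part for `Φ`, with the square root cleared. -/
theorem PhiSystem.smul_space (hΦ : PhiSystem A s q r Φ Ψ) (hs : IsSqrtAlpha q r s) (n : ℤ)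
    (t : ℝ) : s n t • Φ (n + 1) t = A.mulVec (Φ n t) + q n t • Ψ n t := by
  rw [hΦ.space, smul_smul, mul_inv_cancel₀ (hs.ne_zero n t), one_smul]

theorem PsiSystem.smul_space (hΨ : PsiSystem A s q r Φ Ψ) (hs : IsSqrtAlpha q r s) (n : ℤ)
    (t : ℝ) : s n t • Ψ (n + 1) t = r n t • Φ n t + A⁻¹.mulVec (Ψ n t) := by
  rw [hΨ.space, smul_smul, mul_inv_cancel₀ (hs.ne_zero n t), one_smul]

theorem PhiSystem.smul_pow_space (hΦ : PhiSystem A s q r Φ Ψ) (hs : IsSqrtAlpha q r s) (n : ℤ)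
    (t : ℝ) (k : ℕ) : s n t • (A ^ k).mulVec (Φ (n + 1) t)
      = (A ^ (k + 1)).mulVec (Φ n t) + q n t • (A ^ k).mulVec (Ψ n t) := by
  rw [← Matrix.mulVec_smul, hΦ.smul_space hs, Matrix.mulVec_add, Matrix.mulVec_smul,
    Matrix.mulVec_mulVec, pow_succ]

theorem PsiSystem.smul_pow_space (hΨ : PsiSystem A s q r Φ Ψ) (hs : IsSqrtAlpha q r s)
    (hA : IsUnit A.det) (n : ℤ) (t : ℝ) (k : ℕ) :
    s n t • (A ^ (k + 1)).mulVec (Ψ (n + 1) t)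
      = (A ^ k).mulVec (Ψ n t) + r n t • (A ^ (k + 1)).mulVec (Φ n t) := by
  rw [← Matrix.mulVec_smul, hΨ.smul_space hs, Matrix.mulVec_add, Matrix.mulVec_smul,
    Matrix.mulVec_mulVec, pow_succ, mul_assoc, Matrix.mul_nonsing_inv A hA, mul_one]
  exact add_comm _ _

/-- `F` in terms of the wave functions at one site, the multiples of `A ^ (2 j) Ψₙ` in
`A ^ (2 j) Φₙ₊₁` being irrelevant. -/
theorem casF_eq_same_site (hΦ : PhiSystem A s q r Φ Ψ) (hs : IsSqrtAlpha q r s) (n : ℤ) (t : ℝ) :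
    casF A s Φ Ψ n t = casoratian m (fun j => (A ^ (2 * j + 1)).mulVec (Φ n t))
      (fun j => (A ^ (2 * j)).mulVec (Ψ n t)) := by
  rw [casF_eq_casoratian, casoratian_mul_left]
  simp only [hΦ.smul_pow_space hs]
  exact casoratian_add_left (fun _ => q n t)

theorem casH_eq_mixed (hΦ : PhiSystem A s q r Φ Ψ) (hs : IsSqrtAlpha q r s) (n : ℤ) (t : ℝ) :
    casH A s Φ Ψ n t = casoratian m
      (fun j => if j = m then s n t • Ψ (n + 1) t else (A ^ (2 * j + 2)).mulVec (Φ n t))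
      (fun j => (A ^ (2 * j + 1)).mulVec (Ψ n t)) := by
  rw [casH_eq_casoratian, casoratian_mul_left,
    ← casoratian_add_left
      (u := fun j => if j = m then s n t • Ψ (n + 1) t else (A ^ (2 * j + 2)).mulVec (Φ n t))
      (fun j => if j = m then 0 else q n t)]
  congr 1
  funext j
  by_cases hj : j = m
  · simp [hj]
  · simp only [hj, if_false, hΦ.smul_pow_space hs]

theorem casG_eq_mixed (hΦ : PhiSystem A s q r Φ Ψ) (hs : IsSqrtAlpha q r s) (n : ℤ) (t : ℝ) :
    casG A s Φ Ψ n t = casoratian m (fun j => (A ^ (2 * j)).mulVec (Φ n t))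
      (fun j => if j = 0 then
          (A ^ (2 * m + 2)).mulVec (Φ n t) + q n t • (A ^ (2 * m + 1)).mulVec (Ψ n t)
        else (A ^ (2 * j - 1)).mulVec (Ψ n t)) := by
  -- the factor `s ^ (m + 1)` is spread over the `m + 1` columns that contain `Φₙ₊₁`
  have h := casoratian_smul (m := m)
    (u := fun j => if j = 0 then Φ n t else (A ^ (2 * j - 1)).mulVec (Φ (n + 1) t))
    (v := fun j => if j = 0 then (A ^ (2 * m + 1)).mulVec (Φ (n + 1) t)
          else (A ^ (2 * j - 1)).mulVec (Ψ n t))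
    (fun j => if j = 0 then 1 else s n t) (fun j => if j = 0 then s n t else 1)
  rw [Finset.prod_range_succ', Finset.prod_range_succ'] at h
  simp only [Nat.succ_ne_zero, if_true, if_false, Finset.prod_const, Finset.card_range, one_pow,
    mul_one, one_mul, ← pow_succ] at h
  rw [casG_eq_casoratian, ← h,
    ← casoratian_add_left (u := fun j => (A ^ (2 * j)).mulVec (Φ n t))
      (fun j => if j = 0 then 0 else q n t)]
  congr 1
  · funext j
    rcases j with _ | j
    · simp
    · have e : 2 * (j + 1) - 1 + 1 = 2 * (j + 1) := by omega
      simp only [Nat.succ_ne_zero, if_false, hΦ.smul_pow_space hs, e]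
  · funext j
    rcases j with _ | j
    · simp only [if_true, hΦ.smul_pow_space hs]
    · simp

variable {x y z w : ℂ[X]}

theorem DarbouxRelation.pow_mulVec_left {M : Mat m} {a b : Fin (2 * m + 2) → ℂ}
    (D : DarbouxRelation M a b x y z w) : (M ^ (m + 1)).mulVec a = polyComb M a b x y := by
  have h := D.first
  rw [← zero_sub, polyComb_sub, sub_eq_zero] at h
  rw [← h]
  simp [polyComb]

theorem DarbouxRelation.pow_mulVec_right {M : Mat m} {a b : Fin (2 * m + 2) → ℂ}
    (D : DarbouxRelation M a b x y z w) : (M ^ (m + 1)).mulVec b = polyComb M a b z w := by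
  have h := D.second
  rw [← zero_sub z, polyComb_sub, sub_eq_zero] at h
  rw [← h]
  simp [polyComb]

/-- The lowest coefficient matrix of the Darboux relation has determinant `|M|`: applying `M` to the
Krylov vectors shifts them by one and replaces the two lowest by the right sides of the relation. -/
theorem DarbouxRelation.det_coeff_zero {M : Mat m} {a b : Fin (2 * m + 2) → ℂ}
    (D : DarbouxRelation M a b x y z w) (h : krylovDet M a b ≠ 0) :
    x.coeff 0 * w.coeff 0 - y.coeff 0 * z.coeff 0 = M.det := by
  have h1 := casoratian_replace_heads (M := M) (a := a) (b := b) D.natDegree_x D.natDegree_y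
    D.natDegree_z D.natDegree_w
  rw [← casoratian_rotate, ← D.pow_mulVec_left, ← D.pow_mulVec_right] at h1
  have h2 := casoratian_mulVec (u := fun j => (M ^ j).mulVec a) (v := fun j => (M ^ j).mulVec b) M
  refine mul_right_cancel₀ h (h1.symm.trans (Eq.trans ?_ h2))
  congr 1 <;>
  · funext j
    by_cases hj : j = m
    · simp [hj, Matrix.mulVec_mulVec, ← pow_succ']
    · simp [hj, Matrix.mulVec_mulVec, ← pow_succ']

theorem pow_mulVec_inv_mulVec (hA : IsUnit A.det) (k : ℕ) (v : Fin (2 * m + 2) → ℂ) :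
    (A ^ (k + 1)).mulVec (A⁻¹.mulVec v) = (A ^ k).mulVec v := by
  rw [Matrix.mulVec_mulVec, pow_succ, mul_assoc, Matrix.mul_nonsing_inv A hA, mul_one]

/-- `F` is `|A|` times the Krylov determinant of `A²`, `Φₙ` and `A⁻¹Ψₙ`. -/
theorem casF_eq_krylovDet (hA : IsUnit A.det) (hΦ : PhiSystem A s q r Φ Ψ)
    (hs : IsSqrtAlpha q r s) (n : ℤ) (t : ℝ) :
    casF A s Φ Ψ n t = A.det * krylovDet (A ^ 2) (Φ n t) (A⁻¹.mulVec (Ψ n t)) := by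
  rw [casF_eq_same_site hΦ hs, krylovDet, ← casoratian_mulVec]
  congr 1
  · funext j
    rw [Matrix.mulVec_mulVec, ← pow_mul, pow_succ']
  · funext j
    rw [Matrix.mulVec_mulVec (M := A), ← pow_mul, ← pow_succ', pow_mulVec_inv_mulVec hA]

/-- By Cramer's rule, `G` is the lowest coefficient `y₀ + qₙ w₀` times the Krylov determinant. -/
theorem casG_eq_coeff (hA : IsUnit A.det) (hΦ : PhiSystem A s q r Φ Ψ)
    (hs : IsSqrtAlpha q r s)
    (D : DarbouxRelation (A ^ 2) (Φ n t) (A⁻¹.mulVec (Ψ n t)) x y z w) :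
    casG A s Φ Ψ n t = (y.coeff 0 + q n t * w.coeff 0)
      * krylovDet (A ^ 2) (Φ n t) (A⁻¹.mulVec (Ψ n t)) := by
  have hy : (y + C (q n t) * w).natDegree ≤ m :=
    (natDegree_add_le _ _).trans (max_le D.natDegree_y
      ((natDegree_C_mul_le _ _).trans D.natDegree_w))
  have hx : (x + C (q n t) * z).natDegree ≤ m :=
    (natDegree_add_le _ _).trans (max_le D.natDegree_x
      ((natDegree_C_mul_le _ _).trans D.natDegree_z))
  have h := casoratian_replace_heads (M := A ^ 2) (a := Φ n t) (b := A⁻¹.mulVec (Ψ n t))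
    (p := 1) (q := 0) (by simp) (by simp) hx hy
  rw [polyComb_add, polyComb_mul, ← D.pow_mulVec_left, ← D.pow_mulVec_right] at h
  simp only [coeff_add, coeff_C_mul, coeff_one_zero, coeff_zero, one_mul, zero_mul, sub_zero] at h
  rw [← h, casG_eq_mixed hΦ hs]
  congr 1
  · funext j
    rcases j with _ | j
    · simp [polyComb]
    · simp [← pow_mul]
  · funext j
    rcases j with _ | j
    · have e : 2 * (m + 1) = 2 * m + 1 + 1 := by ring
      simp only [if_true, ← pow_mul, e, aeval_C, pow_mulVec_inv_mulVec hA,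
        Algebra.algebraMap_eq_smul_one, Matrix.smul_mulVec, Matrix.one_mulVec]
    · have e : 2 * (j + 1) = 2 * j + 1 + 1 := by ring
      have e' : 2 * j + 1 + 1 - 1 = 2 * j + 1 := by omega
      simp only [Nat.succ_ne_zero, if_false, ← pow_mul, e, e', pow_mulVec_inv_mulVec hA]

/-- By Cramer's rule, `H` is the combination `rₙ w₀ - z₀` of lowest coefficients times the Krylov
determinant. -/
theorem casH_eq_coeff (hA : IsUnit A.det) (hΦ : PhiSystem A s q r Φ Ψ)
    (hΨ : PsiSystem A s q r Φ Ψ) (hs : IsSqrtAlpha q r s)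
    (D : DarbouxRelation (A ^ 2) (Φ n t) (A⁻¹.mulVec (Ψ n t)) x y z w) :
    casH A s Φ Ψ n t = (r n t * w.coeff 0 - z.coeff 0)
      * krylovDet (A ^ 2) (Φ n t) (A⁻¹.mulVec (Ψ n t)) := by
  have h := casoratian_replace_heads (M := A ^ 2) (a := Φ n t) (b := A⁻¹.mulVec (Ψ n t))
    (p := C (r n t)) (q := 1) (by simp) (by simp) D.natDegree_z D.natDegree_w
  rw [← D.pow_mulVec_right, ← casoratian_rotate] at h
  simp only [coeff_C_zero, coeff_one_zero, one_mul] at h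
  rw [← h, casH_eq_mixed hΦ hs]
  congr 1
  · funext j
    by_cases hj : j = m
    · simp [hj, hΨ.smul_space hs, polyComb, Algebra.algebraMap_eq_smul_one, Matrix.smul_mulVec]
    · have e : 2 * (j + 1) = 2 * j + 2 := by ring
      simp [hj, ← pow_mul, e]
  · funext j
    have e : 2 * (j + 1) = 2 * j + 1 + 1 := by ring
    have e' : (A ^ (2 * j + 1)).mulVec (Ψ n t)
        = ((A ^ 2) ^ (j + 1)).mulVec (A⁻¹.mulVec (Ψ n t)) := by
      rw [← pow_mul, e, pow_mulVec_inv_mulVec hA]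
    by_cases hj : j = m
    · simp only [hj] at e' ⊢
      simp [e']
    · simp [hj, e']
end
end

/-! ### Differentiability of the Darboux coefficients -/

section
open Polynomial
variable {m : ℕ}

theorem differentiableAt_det {n : Type*} [Fintype n] [DecidableEq n] {K : ℝ → Matrix n n ℂ}
    {t : ℝ} (hK : ∀ i j, DifferentiableAt ℝ (fun τ => K τ i j) t) :
    DifferentiableAt ℝ (fun τ => (K τ).det) t := by
  simp only [Matrix.det_apply]
  refine DifferentiableAt.fun_sum fun σ _ => DifferentiableAt.const_smul ?_ _
  exact DifferentiableAt.fun_finsetProd fun i _ => hK _ _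

theorem hasDerivAt_mulVec (N : Mat m) {v : ℝ → Fin (2 * m + 2) → ℂ} {v' : Fin (2 * m + 2) → ℂ}
    {t : ℝ} (hv : HasDerivAt v v' t) :
    HasDerivAt (fun τ => N.mulVec (v τ)) (N.mulVec v') t := by
  rw [hasDerivAt_pi] at hv ⊢
  intro i
  simp only [Matrix.mulVec, dotProduct]
  exact HasDerivAt.fun_sum fun j _ => (hv j).const_mul _

theorem hasDerivAt_aeval_mulVec (M : Mat m) {k : ℕ} {p : ℝ → ℂ[X]} {p' : ℂ[X]}
    {v : ℝ → Fin (2 * m + 2) → ℂ} {v' : Fin (2 * m + 2) → ℂ} {t : ℝ}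
    (hp : ∀ τ, (p τ).natDegree ≤ k) (hp' : p'.natDegree ≤ k)
    (hc : ∀ j, HasDerivAt (fun τ => (p τ).coeff j) (p'.coeff j) t) (hv : HasDerivAt v v' t) :
    HasDerivAt (fun τ => (aeval M (p τ)).mulVec (v τ))
      ((aeval M p').mulVec (v t) + (aeval M (p t)).mulVec v') t := by
  simp only [aeval_mulVec_eq_sum _ hp', aeval_mulVec_eq_sum _ (hp _)]
  rw [← Finset.sum_add_distrib]
  refine HasDerivAt.fun_sum fun j _ => ?_
  exact ((hc j).smul (hasDerivAt_mulVec (M ^ j) hv)).congr_deriv (add_comm _ _)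

/-- The polynomial of degree at most `m` with coefficients `c 0, …, c m`. -/
def truncPoly (m : ℕ) (c : Fin (m + 1) → ℂ) : ℂ[X] := ∑ j : Fin (m + 1), C (c j) * X ^ j.val

theorem natDegree_truncPoly (c : Fin (m + 1) → ℂ) : (truncPoly m c).natDegree ≤ m :=
  natDegree_sum_le_of_forall_le _ _ fun j _ =>
    (natDegree_C_mul_X_pow_le _ _).trans (Nat.lt_succ_iff.1 j.2)

theorem coeff_truncPoly (c : Fin (m + 1) → ℂ) (k : ℕ) :
    (truncPoly m c).coeff k = ∑ j : Fin (m + 1), if k = j.val then c j else 0 := by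
  simp [truncPoly, coeff_X_pow]

theorem coeff_truncPoly_fin (c : Fin (m + 1) → ℂ) (k : Fin (m + 1)) :
    (truncPoly m c).coeff k = c k := by
  simp [coeff_truncPoly, Fin.val_inj]

theorem hasDerivAt_coeff_truncPoly {c : ℝ → Fin (m + 1) → ℂ} {c' : Fin (m + 1) → ℂ} {t : ℝ}
    (hc : ∀ j, HasDerivAt (fun τ => c τ j) (c' j) t) (k : ℕ) :
    HasDerivAt (fun τ => (truncPoly m (c τ)).coeff k) ((truncPoly m c').coeff k) t := by
  simp only [coeff_truncPoly]
  refine HasDerivAt.fun_sum fun j _ => ?_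
  by_cases h : k = j.val
  · simpa [h] using hc j
  · simpa [h] using hasDerivAt_const t (0 : ℂ)

/-- The coordinates of `v` along the Krylov vectors, by Cramer's rule; meaningful where the Krylov
determinant does not vanish. -/
def krylovCoord (M : Mat m) (a b v : Fin (2 * m + 2) → ℂ) (i : Fin (2 * m + 2)) : ℂ :=
  (krylovMat M a b).cramer v i / krylovDet M a b

/-- The part of `krylovCoord` along the iterates of `a`, as a polynomial. -/
def krylovLeft (M : Mat m) (a b v : Fin (2 * m + 2) → ℂ) : ℂ[X] :=
  truncPoly m fun j => krylovCoord M a b v (blockEquiv m (Sum.inl j))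

/-- The part of `krylovCoord` along the iterates of `b`, as a polynomial. -/
def krylovRight (M : Mat m) (a b v : Fin (2 * m + 2) → ℂ) : ℂ[X] :=
  truncPoly m fun j => krylovCoord M a b v (blockEquiv m (Sum.inr j))

theorem polyComb_krylov {M : Mat m} {a b : Fin (2 * m + 2) → ℂ} (h : krylovDet M a b ≠ 0)
    (v : Fin (2 * m + 2) → ℂ) :
    polyComb M a b (krylovLeft M a b v) (krylovRight M a b v) = v := by
  have hl : (krylovLeft M a b v).natDegree ≤ m := natDegree_truncPoly _
  have hr : (krylovRight M a b v).natDegree ≤ m := natDegree_truncPoly _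
  rw [← krylovMat_mulVec_pairVec hl hr]
  have hc : pairVec m (krylovLeft M a b v) (krylovRight M a b v)
      = (krylovDet M a b)⁻¹ • (krylovMat M a b).cramer v := by
    funext i
    obtain ⟨j, rfl⟩ := (blockEquiv m).surjective i
    rcases j with j | j
    · simp [pairVec, krylovLeft, coeff_truncPoly_fin, krylovCoord, div_eq_inv_mul]
    · simp [pairVec, krylovRight, coeff_truncPoly_fin, krylovCoord, div_eq_inv_mul]
  rw [hc, Matrix.mulVec_smul, Matrix.mulVec_cramer, smul_smul, det_krylovMat, inv_mul_cancel₀ h,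
    one_smul]

/-- Where the Krylov determinant does not vanish, expanding `M ^ (m + 1) a` and `M ^ (m + 1) b`
along the Krylov vectors gives the Darboux relation. -/
theorem darbouxRelation_krylov {M : Mat m} {a b : Fin (2 * m + 2) → ℂ}
    (h : krylovDet M a b ≠ 0) :
    DarbouxRelation M a b (krylovLeft M a b ((M ^ (m + 1)).mulVec a))
      (krylovRight M a b ((M ^ (m + 1)).mulVec a)) (krylovLeft M a b ((M ^ (m + 1)).mulVec b))
      (krylovRight M a b ((M ^ (m + 1)).mulVec b)) where
  natDegree_x := natDegree_truncPoly _
  natDegree_y := natDegree_truncPoly _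
  natDegree_z := natDegree_truncPoly _
  natDegree_w := natDegree_truncPoly _
  first := by
    rw [← zero_sub, polyComb_sub, polyComb_krylov h]
    simp [polyComb]
  second := by
    rw [← zero_sub (krylovLeft _ _ _ _), polyComb_sub, polyComb_krylov h]
    simp [polyComb]

section
variable {M : Mat m} {a b v : ℝ → Fin (2 * m + 2) → ℂ} {t : ℝ}

theorem differentiableAt_krylovMat_apply (ha : DifferentiableAt ℝ a t)
    (hb : DifferentiableAt ℝ b t) (i j : Fin (2 * m + 2)) :
    DifferentiableAt ℝ (fun τ => krylovMat M (a τ) (b τ) i j) t := by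
  have key : ∀ {u : ℝ → Fin (2 * m + 2) → ℂ}, DifferentiableAt ℝ u t → ∀ k : ℕ,
      DifferentiableAt ℝ (fun τ => (M ^ k).mulVec (u τ) i) t := fun hu k =>
    (hasDerivAt_pi.1 (hasDerivAt_mulVec (M ^ k) hu.hasDerivAt) i).differentiableAt
  by_cases h : j.val ≤ m
  · simpa only [krylovMat, Matrix.of_apply, h, if_true] using key ha _
  · simpa only [krylovMat, Matrix.of_apply, h, if_false] using key hb _

theorem differentiableAt_krylovDet (ha : DifferentiableAt ℝ a t) (hb : DifferentiableAt ℝ b t) :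
    DifferentiableAt ℝ (fun τ => krylovDet M (a τ) (b τ)) t := by
  simp only [← det_krylovMat]
  exact differentiableAt_det (differentiableAt_krylovMat_apply ha hb)

theorem differentiableAt_krylovCoord (ha : DifferentiableAt ℝ a t) (hb : DifferentiableAt ℝ b t)
    (hv : DifferentiableAt ℝ v t) (h : krylovDet M (a t) (b t) ≠ 0) (i : Fin (2 * m + 2)) :
    DifferentiableAt ℝ (fun τ => krylovCoord M (a τ) (b τ) (v τ) i) t := by
  refine DifferentiableAt.div ?_ (differentiableAt_krylovDet ha hb) h
  simp only [Matrix.cramer_apply]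
  refine differentiableAt_det fun k l => ?_
  by_cases hl : l = i
  · subst hl
    simpa using differentiableAt_pi.1 hv k
  · simpa [Matrix.updateCol_apply, hl] using differentiableAt_krylovMat_apply ha hb k l

/-- The coordinate polynomials of a differentiable vector have coefficients that are differentiable
in time; the derivatives are collected in polynomials of the same degree. -/
theorem exists_hasDerivAt_krylov (ha : DifferentiableAt ℝ a t) (hb : DifferentiableAt ℝ b t)
    (hv : DifferentiableAt ℝ v t) (h : krylovDet M (a t) (b t) ≠ 0) :
    ∃ p' q' : ℂ[X], p'.natDegree ≤ m ∧ q'.natDegree ≤ m ∧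
      (∀ k, HasDerivAt (fun τ => (krylovLeft M (a τ) (b τ) (v τ)).coeff k) (p'.coeff k) t) ∧
      (∀ k, HasDerivAt (fun τ => (krylovRight M (a τ) (b τ) (v τ)).coeff k) (q'.coeff k) t) :=
  ⟨truncPoly m fun j => deriv (fun τ => krylovCoord M (a τ) (b τ) (v τ)
      (blockEquiv m (Sum.inl j))) t,
    truncPoly m fun j => deriv (fun τ => krylovCoord M (a τ) (b τ) (v τ)
      (blockEquiv m (Sum.inr j))) t,
    natDegree_truncPoly _, natDegree_truncPoly _,
    hasDerivAt_coeff_truncPoly fun _ => (differentiableAt_krylovCoord ha hb hv h _).hasDerivAt,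
    hasDerivAt_coeff_truncPoly fun _ => (differentiableAt_krylovCoord ha hb hv h _).hasDerivAt⟩

/-- A relation that holds in a neighbourhood of `t` can be differentiated at `t`. -/
theorem deriv_relation {f g : ℝ → ℂ[X]} {f' g' : ℂ[X]} {a' b' : Fin (2 * m + 2) → ℂ} {k : ℕ}
    (ha : HasDerivAt a a' t) (hb : HasDerivAt b b' t)
    (hf : ∀ τ, (f τ).natDegree ≤ k) (hg : ∀ τ, (g τ).natDegree ≤ k)
    (hf' : f'.natDegree ≤ k) (hg' : g'.natDegree ≤ k)
    (hcf : ∀ j, HasDerivAt (fun τ => (f τ).coeff j) (f'.coeff j) t)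
    (hcg : ∀ j, HasDerivAt (fun τ => (g τ).coeff j) (g'.coeff j) t)
    (hrel : ∀ᶠ τ in nhds t, polyComb M (a τ) (b τ) (f τ) (g τ) = 0) :
    polyComb M (a t) (b t) f' g' + ((aeval M (f t)).mulVec a' + (aeval M (g t)).mulVec b') = 0 := by
  have h := (hasDerivAt_aeval_mulVec M hf hf' hcf ha).add
    (hasDerivAt_aeval_mulVec M hg hg' hcg hb)
  have h0 := (hasDerivAt_const t (0 : Fin (2 * m + 2) → ℂ)).congr_of_eventuallyEq hrel
  rw [polyComb, add_add_add_comm]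
  exact h.unique h0

end
end

/-! ### Covariance of the unreduced system -/

section
open Polynomial
variable {m : ℕ}

theorem mul_aeval_sq_comm (A : Mat m) (f : ℂ[X]) :
    A * aeval (A ^ 2) f = aeval (A ^ 2) f * A := by
  have h : aeval (A ^ 2) f = aeval A (f.comp (X ^ 2)) := by simp [aeval_comp]
  rw [h]
  have h2 := congrArg (aeval A) (mul_comm X (f.comp (X ^ 2)))
  rwa [map_mul, map_mul, aeval_X] at h2

/-- A differentiated relation becomes a relation again once the velocities `a'`, `b'`, multiplied by
`M`, are expressed through `a` and `b`. -/
theorem polyComb_time {M : Mat m} {a b a' b' : Fin (2 * m + 2) → ℂ} {f g f' g' : ℂ[X]}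
    {α₁ α₂ β₁ β₂ : ℂ[X]} (ha : M.mulVec a' = polyComb M a b α₁ α₂)
    (hb : M.mulVec b' = polyComb M a b β₁ β₂)
    (h : polyComb M a b f' g' + ((aeval M f).mulVec a' + (aeval M g).mulVec b') = 0) :
    polyComb M a b (X * f' + f * α₁ + g * β₁) (X * g' + f * α₂ + g * β₂) = 0 := by
  have comm : ∀ (p : ℂ[X]) (v : Fin (2 * m + 2) → ℂ),
      M.mulVec ((aeval M p).mulVec v) = (aeval M p).mulVec (M.mulVec v) := fun p v => by
    have h2 := congrArg (aeval M) (mul_comm X p)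
    rw [map_mul, map_mul, aeval_X] at h2
    rw [Matrix.mulVec_mulVec, Matrix.mulVec_mulVec, h2]
  have h1 := congrArg M.mulVec h
  rw [Matrix.mulVec_add, Matrix.mulVec_add, comm, comm, ha, hb, Matrix.mulVec_zero] at h1
  rw [polyComb_add, polyComb_add, polyComb_mul, polyComb_mul, polyComb_mul, aeval_X, ← h1,
    add_assoc]

section
variable {A : Mat m} {s q r : Field1} {Φ Ψ : VecField m}

/-- Relations between `Φ`, `A⁻¹Ψ` transport from a site to the previous one. -/
theorem polyComb_shift (hA : IsUnit A.det) (hΦ : PhiSystem A s q r Φ Ψ)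
    (hΨ : PsiSystem A s q r Φ Ψ) (hs : IsSqrtAlpha q r s) (n : ℤ) (t : ℝ) (f g : ℂ[X])
    (h : polyComb (A ^ 2) (Φ (n + 1) t) (A⁻¹.mulVec (Ψ (n + 1) t)) f g = 0) :
    polyComb (A ^ 2) (Φ n t) (A⁻¹.mulVec (Ψ n t)) (X * f + C (r n t) * g)
      (C (q n t) * (X * f) + g) = 0 := by
  have h1 : polyComb (A ^ 2) (Φ n t) (A⁻¹.mulVec (Ψ n t)) X (C (q n t) * X)
      = A.mulVec (s n t • Φ (n + 1) t) := by
    rw [hΦ.smul_space hs, Matrix.mulVec_add, Matrix.mulVec_mulVec, Matrix.mulVec_smul, polyComb,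
      map_mul, aeval_X, aeval_C, Algebra.algebraMap_eq_smul_one, smul_mul_assoc, one_mul,
      Matrix.smul_mulVec, pow_mulVec_inv_mulVec hA 1, pow_one, pow_two]
  have h2 : polyComb (A ^ 2) (Φ n t) (A⁻¹.mulVec (Ψ n t)) (C (r n t)) 1
      = A.mulVec (s n t • A⁻¹.mulVec (Ψ (n + 1) t)) := by
    rw [← Matrix.mulVec_smul, Matrix.mulVec_mulVec, Matrix.mul_nonsing_inv A hA,
      Matrix.one_mulVec, hΨ.smul_space hs, polyComb, aeval_C, map_one,
      Algebra.algebraMap_eq_smul_one, Matrix.smul_mulVec, Matrix.one_mulVec, Matrix.one_mulVec]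
  have h3 : polyComb (A ^ 2) (Φ n t) (A⁻¹.mulVec (Ψ n t)) (X * f + C (r n t) * g)
      (C (q n t) * (X * f) + g) = s n t • A.mulVec
        (polyComb (A ^ 2) (Φ (n + 1) t) (A⁻¹.mulVec (Ψ (n + 1) t)) f g) := by
    have e1 : X * f + C (r n t) * g = f * X + g * C (r n t) := by ring
    have e2 : C (q n t) * (X * f) + g = f * (C (q n t) * X) + g * 1 := by ring
    rw [e1, e2, polyComb_add, polyComb_mul, polyComb_mul, h1, h2, Matrix.mulVec_mulVec,
      Matrix.mulVec_mulVec, ← mul_aeval_sq_comm, ← mul_aeval_sq_comm, Matrix.mulVec_smul,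
      Matrix.mulVec_smul, ← smul_add, ← Matrix.mulVec_mulVec, ← Matrix.mulVec_mulVec,
      ← Matrix.mulVec_add]
    rfl
  rw [h3, h, Matrix.mulVec_zero, smul_zero]

/-- The velocity of `Φ`, multiplied by `A²`, in terms of `Φ` and `A⁻¹Ψ`. -/
theorem sq_mulVec_velocity_left (hA : IsUnit A.det) (φ ψ : Fin (2 * m + 2) → ℂ)
    (κ q qm : ℂ) :
    (A ^ 2).mulVec ((1 / 2 : ℂ) • ((A ^ 2 - A⁻¹ ^ 2 + κ • (1 : Mat m)).mulVec φ
        + ((2 * q) • A + (2 * qm) • A⁻¹).mulVec ψ))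
      = polyComb (A ^ 2) φ (A⁻¹.mulVec ψ)
        (C (1 / 2) * (X * X) + C (κ / 2) * X + C (-1 / 2))
        (C q * (X * X) + C qm * X + C 0) := by
  have hAB : A * A⁻¹ = 1 := Matrix.mul_nonsing_inv A hA
  have i1 : A ^ 2 * A⁻¹ ^ 2 = 1 := by
    rw [pow_two, pow_two, mul_assoc, ← mul_assoc A A⁻¹, hAB, one_mul, hAB]
  have i2 : A ^ 2 * A⁻¹ = A := by rw [pow_two, mul_assoc, hAB, mul_one]
  have i3 : A ^ 2 * A ^ 2 * A⁻¹ = A ^ 2 * A := by rw [mul_assoc, i2]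
  simp only [polyComb, map_add, map_mul, aeval_X, aeval_C, Algebra.algebraMap_eq_smul_one,
    smul_mul_assoc, one_mul, Matrix.add_mulVec, Matrix.sub_mulVec, Matrix.mulVec_add,
    Matrix.mulVec_sub, Matrix.mulVec_smul, Matrix.smul_mulVec, Matrix.mulVec_mulVec,
    Matrix.one_mulVec, i1, i2, i3, add_mul]
  module

/-- The velocity of `A⁻¹Ψ`, multiplied by `A²`, in terms of `Φ` and `A⁻¹Ψ`. -/
theorem sq_mulVec_velocity_right (hA : IsUnit A.det) (φ ψ : Fin (2 * m + 2) → ℂ)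
    (κ r rm : ℂ) :
    (A ^ 2).mulVec (A⁻¹.mulVec ((1 / 2 : ℂ) • (((2 * rm) • A + (2 * r) • A⁻¹).mulVec φ
        + (A⁻¹ ^ 2 - A ^ 2 - κ • (1 : Mat m)).mulVec ψ)))
      = polyComb (A ^ 2) φ (A⁻¹.mulVec ψ)
        (C 0 * (X * X) + C rm * X + C r)
        (C (-1 / 2) * (X * X) + C (-κ / 2) * X + C (1 / 2)) := by
  have hAB : A * A⁻¹ = 1 := Matrix.mul_nonsing_inv A hA
  have i2 : A ^ 2 * A⁻¹ = A := by rw [pow_two, mul_assoc, hAB, mul_one]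
  have i3 : A ^ 2 * A ^ 2 * A⁻¹ = A ^ 2 * A := by rw [mul_assoc, i2]
  have i4 : A * A⁻¹ ^ 2 = A⁻¹ := by rw [pow_two, ← mul_assoc, hAB, one_mul]
  have i6 : ∀ N : Mat m, A ^ 2 * (A⁻¹ * N) = A * N := fun N => by rw [← mul_assoc, i2]
  have i7 : A * A = A ^ 2 := (pow_two A).symm
  have i5 : A * A ^ 2 = A ^ 2 * A := by rw [← pow_succ, ← pow_succ']
  simp only [polyComb, map_add, map_mul, aeval_X, aeval_C, Algebra.algebraMap_eq_smul_one,
    smul_mul_assoc, one_mul, Matrix.add_mulVec, Matrix.sub_mulVec, Matrix.mulVec_add,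
    Matrix.mulVec_sub, Matrix.mulVec_smul, Matrix.smul_mulVec, Matrix.mulVec_mulVec,
    Matrix.one_mulVec, i2, i3, i4, i5, i6, i7, hAB, add_mul]
  module

/-- The elimination of the Darboux coefficients, leaving `Q` and `R` only. Here `d = |A|`;
`x, y, z, w` are the lowest coefficients at the present site and `Y`, `W` the derivatives of `y`,
`w`; `y₁`, `w₁` are lowest coefficients at the next site, where the background is `qp`; `Qm` is `d`
times the value of `Q` at the previous site, where the background is `qm`; `b, f, g, h` are the
coefficients of degree `m` at the present site. -/
theorem darboux_transformed_flow {d x y z w y₁ w₁ Qm Y W q r qm qp b f g h : ℂ} (hd : d ≠ 0)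
    (hdet : x * w - y * z = d ^ 2)
    (k₂ : w₁ * (x - r * y - q * (r * w - z)) = d ^ 2 * (1 - q * r))
    (k₃ : y₁ * (x - r * y - q * (r * w - z)) = d ^ 2 * (b + q * f - q * g - q ^ 2 * h))
    (key : d ^ 2 * (Y + q * W) = w * d ^ 2 * (qm * (1 - q * r) + b + q * f - q * g - q ^ 2 * h)
      - (d ^ 2 - (y + q * w) * (r * w - z)) * Qm) :
    (Y + ((1 - q * r) * (qp - qm) * w + q * W)) / d
      = (1 - (y + q * w) / d * ((r * w - z) / d)) * ((y₁ + qp * w₁) / d - Qm / d) := by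
  have main : d ^ 2 * (Y + ((1 - q * r) * (qp - qm) * w + q * W))
      = (d ^ 2 - (y + q * w) * (r * w - z)) * (y₁ + qp * w₁ - Qm) := by
    linear_combination key - w * k₃ - w * qp * k₂ + (y₁ + qp * w₁) * hdet
  field_simp
  linear_combination main

/-- Darboux covariance: `Q = G / F` and `R = H / F` satisfy the first equation of the unreduced
system wherever the three denominators involved do not vanish. -/
theorem hasDerivAt_solQ (hA : IsUnit A.det) (hqr : IsCoupledSolution q r)
    (hs : IsSqrtAlpha q r s) (hΦ : PhiSystem A s q r Φ Ψ) (hΨ : PsiSystem A s q r Φ Ψ)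
    {n : ℤ} {t : ℝ} (hFm : casF A s Φ Ψ (n - 1) t ≠ 0) (hF : casF A s Φ Ψ n t ≠ 0)
    (hFp : casF A s Φ Ψ (n + 1) t ≠ 0) :
    HasDerivAt (solQ A s Φ Ψ n) ((1 - solQ A s Φ Ψ n t * solR A s Φ Ψ n t)
      * (solQ A s Φ Ψ (n + 1) t - solQ A s Φ Ψ (n - 1) t)) t := by
  have hd : A.det ≠ 0 := hA.ne_zero
  have ne : ∀ {k τ}, casF A s Φ Ψ k τ ≠ 0 →
      krylovDet (A ^ 2) (Φ k τ) (A⁻¹.mulVec (Ψ k τ)) ≠ 0 := fun h h0 => h (by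
    rw [casF_eq_krylovDet hA hΦ hs, h0, mul_zero])
  have hQ : ∀ {k τ} {x y z w : ℂ[X]}, casF A s Φ Ψ k τ ≠ 0 →
      DarbouxRelation (A ^ 2) (Φ k τ) (A⁻¹.mulVec (Ψ k τ)) x y z w →
      solQ A s Φ Ψ k τ = (y.coeff 0 + q k τ * w.coeff 0) / A.det := fun h D => by
    rw [solQ, casG_eq_coeff hA hΦ hs D, casF_eq_krylovDet hA hΦ hs,
      mul_div_mul_right _ _ (ne h)]
  have hR : ∀ {k τ} {x y z w : ℂ[X]}, casF A s Φ Ψ k τ ≠ 0 →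
      DarbouxRelation (A ^ 2) (Φ k τ) (A⁻¹.mulVec (Ψ k τ)) x y z w →
      solR A s Φ Ψ k τ = (r k τ * w.coeff 0 - z.coeff 0) / A.det := fun h D => by
    rw [solR, casH_eq_coeff hA hΦ hΨ hs D, casF_eq_krylovDet hA hΦ hs,
      mul_div_mul_right _ _ (ne h)]
  have hda := hΦ.time n t
  have hdb := hasDerivAt_mulVec A⁻¹ (hΨ.time n t)
  have hdiff : ∀ u : ℝ → Fin (2 * m + 2) → ℂ, DifferentiableAt ℝ u t →
      DifferentiableAt ℝ (fun τ => ((A ^ 2) ^ (m + 1)).mulVec (u τ)) t := fun u hu =>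
    (hasDerivAt_mulVec _ hu.hasDerivAt).differentiableAt
  obtain ⟨x', y', hx', hy', hdx, hdy⟩ := exists_hasDerivAt_krylov (M := A ^ 2)
    hda.differentiableAt hdb.differentiableAt (hdiff _ hda.differentiableAt) (ne hF)
  obtain ⟨z', w', hz', hw', hdz, hdw⟩ := exists_hasDerivAt_krylov (M := A ^ 2)
    hda.differentiableAt hdb.differentiableAt (hdiff _ hdb.differentiableAt) (ne hF)
  have hev : ∀ᶠ τ in nhds t, krylovDet (A ^ 2) (Φ n τ) (A⁻¹.mulVec (Ψ n τ)) ≠ 0 :=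
    (differentiableAt_krylovDet hda.differentiableAt hdb.differentiableAt).continuousAt.eventually_ne
      (ne hF)
  have D := darbouxRelation_krylov (ne hF)
  have Dp := darbouxRelation_krylov (ne hFp)
  have Dm := darbouxRelation_krylov (ne hFm)
  have h₁ := deriv_relation (M := A ^ 2) (k := m + 1)
    (f := fun τ => X ^ (m + 1) - krylovLeft (A ^ 2) (Φ n τ) (A⁻¹.mulVec (Ψ n τ))
      (((A ^ 2) ^ (m + 1)).mulVec (Φ n τ)))
    (g := fun τ => -krylovRight (A ^ 2) (Φ n τ) (A⁻¹.mulVec (Ψ n τ))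
      (((A ^ 2) ^ (m + 1)).mulVec (Φ n τ)))
    (f' := -x') (g' := -y') hda hdb
    (fun τ => (natDegree_sub_le _ _).trans (max_le (natDegree_X_pow_le _)
      ((natDegree_truncPoly _).trans (by omega))))
    (fun τ => by rw [natDegree_neg]; exact (natDegree_truncPoly _).trans (by omega))
    (by rw [natDegree_neg]; omega) (by rw [natDegree_neg]; omega)
    (fun j => by simpa using (hdx j).const_sub ((X ^ (m + 1) : ℂ[X]).coeff j))
    (fun j => by simpa only [coeff_neg] using (hdy j).fun_neg)
    (hev.mono fun τ h => (darbouxRelation_krylov h).first)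
  have h₂ := deriv_relation (M := A ^ 2) (k := m + 1)
    (f := fun τ => -krylovLeft (A ^ 2) (Φ n τ) (A⁻¹.mulVec (Ψ n τ))
      (((A ^ 2) ^ (m + 1)).mulVec (A⁻¹.mulVec (Ψ n τ))))
    (g := fun τ => X ^ (m + 1) - krylovRight (A ^ 2) (Φ n τ) (A⁻¹.mulVec (Ψ n τ))
      (((A ^ 2) ^ (m + 1)).mulVec (A⁻¹.mulVec (Ψ n τ))))
    (f' := -z') (g' := -w') hda hdb
    (fun τ => by rw [natDegree_neg]; exact (natDegree_truncPoly _).trans (by omega))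
    (fun τ => (natDegree_sub_le _ _).trans (max_le (natDegree_X_pow_le _)
      ((natDegree_truncPoly _).trans (by omega))))
    (by rw [natDegree_neg]; omega) (by rw [natDegree_neg]; omega)
    (fun j => by simpa only [coeff_neg] using (hdz j).fun_neg)
    (fun j => by simpa using (hdw j).const_sub ((X ^ (m + 1) : ℂ[X]).coeff j))
    (hev.mono fun τ h => (darbouxRelation_krylov h).second)
  have p₁ := polyComb_time (sq_mulVec_velocity_left hA _ _ _ _ _)
    (sq_mulVec_velocity_right hA _ _ _ _ _) h₁
  have p₂ := polyComb_time (sq_mulVec_velocity_left hA _ _ _ _ _)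
    (sq_mulVec_velocity_right hA _ _ _ _ _) h₂
  -- near `t` the quotient `G / F` is a combination of coefficients, hence differentiable
  have hder : HasDerivAt (solQ A s Φ Ψ n) _ t :=
    (((hdy 0).add ((hqr.eq_q n t).mul (hdw 0))).div_const A.det).congr_of_eventuallyEq
      (hev.mono fun τ h => hQ (by
        rw [casF_eq_krylovDet hA hΦ hs]; exact mul_ne_zero hd h) (darbouxRelation_krylov h))
  have hshift := polyComb_shift hA hΦ hΨ hs (n - 1) t
  rw [sub_add_cancel] at hshift
  have hdet := D.det_coeff_zero (ne hF)
  have hΔ : (A ^ 2).det ≠ 0 := by rw [Matrix.det_pow]; exact pow_ne_zero _ hd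
  obtain ⟨k₂, k₃, -⟩ := D.shift (ne hF) Dp (q n t) (r n t) (polyComb_shift hA hΦ hΨ hs n t)
    (by rwa [hdet])
  obtain ⟨-, -, k₄⟩ := Dm.shift (ne hFm) D (q (n - 1) t) (r (n - 1) t) hshift
    (by rwa [Dm.det_coeff_zero (ne hFm)])
  have key := D.evolve (ne hF) hx' hy' hz' hw' (q n t) (r n t) (q (n - 1) t) (r (n - 1) t) _ _ rfl
    (by convert p₁ using 2 <;> ring) (by convert p₂ using 2 <;> ring) k₄
  rw [hQ hF D, hQ hFp Dp, hQ hFm Dm, hR hF D]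
  refine hder.congr_deriv ?_
  rw [hdet, Matrix.det_pow] at k₂ k₃ key
  rw [Matrix.det_pow] at hdet
  exact darboux_transformed_flow hd hdet k₂ k₃ key

end
end

/-! ### The semilinear map of the reductions -/

section
variable {m : ℕ}

/-- The semilinear map `v ↦ T σ(v)` relating `Ψ` to `Φ`, where the ring endomorphism `σ` of `ℂ`
is the identity or complex conjugation and acts entrywise. -/
def twist (T : Mat m) (σ : ℂ →+* ℂ) (v : Fin (2 * m + 2) → ℂ) : Fin (2 * m + 2) → ℂ :=
  T.mulVec (σ ∘ v)

section
variable {T : Mat m} {σ : ℂ →+* ℂ}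

theorem twist_add (v w : Fin (2 * m + 2) → ℂ) : twist T σ (v + w) = twist T σ v + twist T σ w := by
  have h : σ ∘ (v + w) = σ ∘ v + σ ∘ w := by ext i; simp
  rw [twist, h, Matrix.mulVec_add]
  rfl

theorem twist_sub (v w : Fin (2 * m + 2) → ℂ) : twist T σ (v - w) = twist T σ v - twist T σ w := by
  have h : σ ∘ (v - w) = σ ∘ v - σ ∘ w := by ext i; simp
  rw [twist, h, Matrix.mulVec_sub]
  rfl

theorem twist_smul (c : ℂ) (v : Fin (2 * m + 2) → ℂ) : twist T σ (c • v) = σ c • twist T σ v := by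
  have h : σ ∘ (c • v) = σ c • (σ ∘ v) := by ext i; simp
  rw [twist, h, Matrix.mulVec_smul]
  rfl

theorem twist_mulVec {P P' : Mat m} (h : P' * T = T * P.map σ) (v : Fin (2 * m + 2) → ℂ) :
    twist T σ (P.mulVec v) = P'.mulVec (twist T σ v) := by
  have h1 : σ ∘ P.mulVec v = (P.map σ).mulVec (σ ∘ v) := by
    ext i
    exact σ.map_mulVec P v i
  rw [twist, twist, h1, Matrix.mulVec_mulVec, Matrix.mulVec_mulVec, h]

theorem twist_pow_mulVec {P P' : Mat m}
    (h : ∀ v, twist T σ (P.mulVec v) = P'.mulVec (twist T σ v)) (k : ℕ)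
    (v : Fin (2 * m + 2) → ℂ) :
    twist T σ ((P ^ k).mulVec v) = (P' ^ k).mulVec (twist T σ v) := by
  induction k generalizing v with
  | zero => simp
  | succ k ih => rw [pow_succ, ← Matrix.mulVec_mulVec, ih, h, Matrix.mulVec_mulVec, ← pow_succ]

theorem twist_twist (hσ : ∀ z, σ (σ z) = z) {ε : ℂ} (hT : T * T.map σ = ε • (1 : Mat m))
    (v : Fin (2 * m + 2) → ℂ) : twist T σ (twist T σ v) = ε • v := by
  have h1 : σ ∘ T.mulVec (σ ∘ v) = (T.map σ).mulVec v := by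
    have h2 : (fun i => σ ((σ ∘ v) i)) = v := by ext i; simp [hσ]
    ext i
    rw [Function.comp_apply, σ.map_mulVec]
    exact congrArg (fun u => (T.map σ).mulVec u i) h2
  rw [twist, twist, h1, Matrix.mulVec_mulVec, hT, Matrix.smul_mulVec, Matrix.one_mulVec]

theorem casoratian_twist (B : Mat m) (u v : ℕ → Fin (2 * m + 2) → ℂ) :
    casoratian m (fun j => B.mulVec (twist T σ (u j))) (fun j => B.mulVec (twist T σ (v j)))
      = (B * T).det * σ (casoratian m u v) := by
  rw [← casoratian_map, ← casoratian_mulVec]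
  simp only [twist, Matrix.mulVec_mulVec]

/-- `σ` commutes with differentiation in real time. -/
def CommutesWithDeriv (σ : ℂ →+* ℂ) : Prop :=
  ∀ (f : ℝ → ℂ) (f' : ℂ) (t : ℝ), HasDerivAt f f' t → HasDerivAt (fun τ => σ (f τ)) (σ f') t

theorem commutesWithDeriv_id : CommutesWithDeriv (RingHom.id ℂ) := fun _ _ _ h => h

theorem commutesWithDeriv_conj : CommutesWithDeriv (starRingEnd ℂ) := fun _ _ _ h => h.star

theorem hasDerivAt_twist (hσ : CommutesWithDeriv σ) {v : ℝ → Fin (2 * m + 2) → ℂ}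
    {v' : Fin (2 * m + 2) → ℂ} {t : ℝ} (hv : HasDerivAt v v' t) :
    HasDerivAt (fun τ => twist T σ (v τ)) (twist T σ v') t := by
  refine hasDerivAt_mulVec T ?_
  rw [hasDerivAt_pi] at hv ⊢
  exact fun i => hσ _ _ _ (hv i)

end

section
variable {δ : ℂ} {A T : Mat m} {q r s : Field1} {Φ Ψ : VecField m} {σ : ℂ →+* ℂ}

theorem map_sign (hδ : δ = 1 ∨ δ = -1) : σ δ = δ := by
  rcases hδ with rfl | rfl <;> simp

theorem mul_self_of_sign (hδ : δ = 1 ∨ δ = -1) : δ * δ = 1 := by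
  rcases hδ with rfl | rfl <;> simp

/-! ### The local (classical) reductions -/

theorem twist_inv_mulVec_of_local (hA : IsUnit A.det)
    (h : ∀ v, twist T σ (A.mulVec v) = A⁻¹.mulVec (twist T σ v)) (v : Fin (2 * m + 2) → ℂ) :
    twist T σ (A⁻¹.mulVec v) = A.mulVec (twist T σ v) := by
  have h1 := h (A⁻¹.mulVec v)
  rw [Matrix.mulVec_mulVec, Matrix.mul_nonsing_inv A hA, Matrix.one_mulVec] at h1
  rw [h1, Matrix.mulVec_mulVec, Matrix.mul_nonsing_inv A hA, Matrix.one_mulVec]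

/-- Applying the semilinear map to the equations for `Φ` gives the companion system. -/
theorem psiSystem_of_local (hA : IsUnit A.det) (hΦ : PhiSystem A s q r Φ Ψ)
    (hσ : ∀ z, σ (σ z) = z) (hσ' : CommutesWithDeriv σ) (hδ : δ = 1 ∨ δ = -1)
    (hr : ∀ n t, r n t = δ * σ (q n t)) (hs : ∀ n t, σ (s n t) = s n t)
    (hΨ : ∀ n t, Ψ n t = twist T σ (Φ n t)) (hAT : A⁻¹ * T = T * A.map σ)
    (hT : T * T.map σ = δ • (1 : Mat m)) : PsiSystem A s q r Φ Ψ := by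
  have h1 := twist_mulVec hAT
  have h2 := twist_inv_mulVec_of_local hA h1
  have h3 : ∀ n t, twist T σ (Ψ n t) = δ • Φ n t := fun n t => by
    rw [hΨ, twist_twist hσ hT]
  have hσδ : σ δ = δ := map_sign hδ
  constructor
  · intro n t
    rw [hΨ (n + 1), hΦ.space, twist_smul, twist_add, twist_smul, h1, ← hΨ, h3, map_inv₀, hs, hr]
    module
  · intro n t
    have hd := hasDerivAt_twist (T := T) hσ' (hΦ.time n t)
    simp only [← hΨ] at hd
    refine hd.congr_deriv ?_
    simp only [Matrix.add_mulVec, Matrix.sub_mulVec, Matrix.smul_mulVec, Matrix.one_mulVec,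
      Matrix.mulVec_smul, twist_add, twist_sub, twist_smul, twist_pow_mulVec h1,
      twist_pow_mulVec h2, h1, h2, h3, ← hΨ, hr, map_sub, map_mul, map_div₀, map_ofNat,
      map_one, hσ, hσδ]
    module

theorem pow_mulVec_inv_pow_mulVec (hA : IsUnit A.det) (k i : ℕ) (v : Fin (2 * m + 2) → ℂ) :
    (A ^ (k + i)).mulVec ((A⁻¹ ^ i).mulVec v) = (A ^ k).mulVec v := by
  induction i generalizing v with
  | zero => simp
  | succ i ih =>
    rw [pow_succ', ← Matrix.mulVec_mulVec, ← add_assoc, pow_mulVec_inv_mulVec hA, ih]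

/-- The map `A ^ (2 m + 1) T σ` sends the columns of `F` to its columns with the blocks exchanged
and each in reverse order, up to scalar factors and irrelevant multiples of other columns. -/
theorem casF_of_local (hA : IsUnit A.det)
    (hΨs : PsiSystem A s q r Φ Ψ) (hα : IsSqrtAlpha q r s) (hΦ : PhiSystem A s q r Φ Ψ)
    (hσ : ∀ z, σ (σ z) = z) (hs : ∀ n t, σ (s n t) = s n t)
    (hΨ : ∀ n t, Ψ n t = twist T σ (Φ n t)) (hAT : A⁻¹ * T = T * A.map σ)
    (hT : T * T.map σ = δ • (1 : Mat m)) (n : ℤ) (t : ℝ) :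
    (A ^ (2 * m + 1) * T).det * σ (casF A s Φ Ψ n t) = (-δ) ^ (m + 1) * casF A s Φ Ψ n t := by
  have h1 := twist_pow_mulVec (twist_mulVec hAT)
  have h3 : ∀ n t, twist T σ (Ψ n t) = δ • Φ n t := fun n t => by
    rw [hΨ, twist_twist hσ hT]
  rw [casF_eq_casoratian, map_mul, map_pow, hs, mul_left_comm, ← casoratian_twist,
    casoratian_mul_left, ← casF_eq_casoratian, casF_eq_same_site hΦ hα]
  simp only [h1, h3, ← hΨ]
  calc _ = casoratian m
        (fun j => (A ^ (2 * (m - j))).mulVec (Ψ n t)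
          + r n t • (A ^ (2 * (m - j) + 1)).mulVec (Φ n t))
        (fun j => δ • (A ^ (2 * (m - j) + 1)).mulVec (Φ n t)) := by
        refine casoratian_congr (fun j hj => ?_) (fun j hj => ?_)
        · have e : 2 * m + 1 = 2 * (m - j) + 1 + 2 * j := by omega
          rw [e, pow_mulVec_inv_pow_mulVec hA, hΨs.smul_pow_space hα hA]
        · have e : 2 * m + 1 = 2 * (m - j) + 1 + 2 * j := by omega
          rw [e, pow_mulVec_inv_pow_mulVec hA, Matrix.mulVec_smul]
    _ = δ ^ (m + 1) * casoratian m
        (fun j => (A ^ (2 * (m - j))).mulVec (Ψ n t)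
          + r n t • (A ^ (2 * (m - j) + 1)).mulVec (Φ n t))
        (fun j => (A ^ (2 * (m - j) + 1)).mulVec (Φ n t)) := by
        have h := casoratian_smul_const (m := m) (u := (fun j => (A ^ (2 * (m - j))).mulVec (Ψ n t)
          + r n t • (A ^ (2 * (m - j) + 1)).mulVec (Φ n t)))
          (v := (fun j => (A ^ (2 * (m - j) + 1)).mulVec (Φ n t))) 1 δ
        simpa only [one_smul, one_pow, one_mul] using h
    _ = δ ^ (m + 1) * casoratian m
        (fun j => (A ^ (2 * j)).mulVec (Ψ n t)) (fun j => (A ^ (2 * j + 1)).mulVec (Φ n t)) := by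
        rw [casoratian_add_left (fun _ => r n t),
          casoratian_reverse (u := fun j => (A ^ (2 * j)).mulVec (Ψ n t))
            (v := fun j => (A ^ (2 * j + 1)).mulVec (Φ n t))]
    _ = _ := by
        rw [casoratian_swap, neg_pow δ]
        ring

/-- The map `A ^ (2 m + 1) T σ` sends the columns of `G` to those of `H` with the blocks exchanged
and each in reverse order, up to scalar factors and irrelevant multiples of other columns. -/
theorem casG_of_local (hA : IsUnit A.det)
    (hΨs : PsiSystem A s q r Φ Ψ) (hα : IsSqrtAlpha q r s) (hΦ : PhiSystem A s q r Φ Ψ)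
    (hσ : ∀ z, σ (σ z) = z) (hs : ∀ n t, σ (s n t) = s n t)
    (hΨ : ∀ n t, Ψ n t = twist T σ (Φ n t)) (hAT : A⁻¹ * T = T * A.map σ)
    (hT : T * T.map σ = δ • (1 : Mat m)) (n : ℤ) (t : ℝ) :
    (A ^ (2 * m + 1) * T).det * σ (casG A s Φ Ψ n t) = -(-δ) ^ m * casH A s Φ Ψ n t := by
  have h1 := twist_pow_mulVec (twist_mulVec hAT)
  have h3 : ∀ n t, twist T σ (Ψ n t) = δ • Φ n t := fun n t => by
    rw [hΨ, twist_twist hσ hT]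
  -- `V`, `U` are the two blocks of `H` in reverse order
  let V : ℕ → Fin (2 * m + 2) → ℂ := fun j =>
    if j = 0 then s n t • Ψ (n + 1) t else (A ^ (2 * (m - j) + 2)).mulVec (Φ n t)
  let U : ℕ → Fin (2 * m + 2) → ℂ := fun j => (A ^ (2 * (m - j) + 1)).mulVec (Ψ n t)
  have hH : casH A s Φ Ψ n t = casoratian m V U := by
    rw [casH_eq_mixed hΦ hα, ← casoratian_reverse]
    refine casoratian_congr (fun j hj => ?_) (fun j hj => rfl)
    by_cases h0 : j = 0
    · simp [V, h0]
    · have h0' : m - j ≠ m := by omega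
      simp only [V, h0, h0', if_false]
  have hG : (A ^ (2 * m + 1) * T).det * σ (casG A s Φ Ψ n t) = casoratian m
      (fun j => U j + (if j = 0 then 0 else r n t) • V j)
      (fun j => (if j = 0 then 1 else δ) • V j) := by
    rw [casG_eq_casoratian, map_mul, map_pow, hs, mul_left_comm, ← casoratian_twist]
    have h := casoratian_smul (m := m)
      (u := fun j => (A ^ (2 * m + 1)).mulVec (twist T σ
        (if j = 0 then Φ n t else (A ^ (2 * j - 1)).mulVec (Φ (n + 1) t))))
      (v := fun j => (A ^ (2 * m + 1)).mulVec (twist T σ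
        (if j = 0 then (A ^ (2 * m + 1)).mulVec (Φ (n + 1) t)
          else (A ^ (2 * j - 1)).mulVec (Ψ n t))))
      (fun j => if j = 0 then 1 else s n t) (fun j => if j = 0 then s n t else 1)
    rw [Finset.prod_range_succ', Finset.prod_range_succ'] at h
    simp only [Nat.succ_ne_zero, if_true, if_false, Finset.prod_const, Finset.card_range, one_pow,
      mul_one, one_mul, ← pow_succ] at h
    rw [← h]
    refine casoratian_congr (fun j hj => ?_) (fun j hj => ?_)
    · by_cases h0 : j = 0
      · simp [h0, U, ← hΨ]
      · have e : 2 * m + 1 = 2 * (m - j) + 1 + 1 + (2 * j - 1) := by omega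
        simp only [h0, if_false, h1, ← hΨ, U, V]
        rw [e, pow_mulVec_inv_pow_mulVec hA, hΨs.smul_pow_space hα hA]
    · by_cases h0 : j = 0
      · have e := pow_mulVec_inv_pow_mulVec hA 0 (2 * m + 1) (Ψ (n + 1) t)
        rw [zero_add, pow_zero, Matrix.one_mulVec] at e
        simp only [h0, if_true, V, h1, ← hΨ, e, one_smul]
      · have e : 2 * m + 1 = 2 * (m - j) + 2 + (2 * j - 1) := by omega
        simp only [h0, if_false, h1, h3, V, one_smul]
        rw [e, pow_mulVec_inv_pow_mulVec hA, Matrix.mulVec_smul]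
  have h := casoratian_smul (m := m) (u := fun j => U j + (if j = 0 then 0 else r n t) • V j)
    (v := V) (fun _ => 1) (fun j => if j = 0 then 1 else δ)
  rw [Finset.prod_range_succ' (fun j => if j = 0 then 1 else δ)] at h
  simp only [Nat.succ_ne_zero, if_true, if_false, Finset.prod_const, Finset.card_range, one_pow,
    mul_one, one_mul, one_smul] at h
  rw [hG, h, casoratian_add_left (fun j => if j = 0 then 0 else r n t), casoratian_swap, hH,
    neg_pow δ]
  ring

/-! ### The nonlocal reductions -/

theorem twist_inv_mulVec_of_nonlocal (hA : IsUnit A.det)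
    (h : ∀ v, twist T σ (A.mulVec v) = A.mulVec (twist T σ v)) (v : Fin (2 * m + 2) → ℂ) :
    twist T σ (A⁻¹.mulVec v) = A⁻¹.mulVec (twist T σ v) := by
  have h1 := h (A⁻¹.mulVec v)
  rw [Matrix.mulVec_mulVec, Matrix.mul_nonsing_inv A hA, Matrix.one_mulVec] at h1
  rw [h1, Matrix.mulVec_mulVec, Matrix.nonsing_inv_mul A hA, Matrix.one_mulVec]

/-- Applying the semilinear map to the equations for `Φ` at the reflected point gives the companion
system. The space part yields the equation for `Ψₙ` in terms of site `n + 1`, which is inverted by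
means of `αₙ = 1 - qₙ rₙ`. -/
theorem psiSystem_of_nonlocal (hA : IsUnit A.det) (hα : IsSqrtAlpha q r s)
    (hΦ : PhiSystem A s q r Φ Ψ)
    (hσ : ∀ z, σ (σ z) = z) (hσ' : CommutesWithDeriv σ) (hδ : δ = 1 ∨ δ = -1)
    (hr : ∀ n t, r n t = δ * σ (q (-n) (-t))) (hs : ∀ n t, σ (s (-n) (-t)) = s n t)
    (hΨ : ∀ n t, Ψ n t = twist T σ (Φ (1 - n) (-t))) (hAT : A * T = T * A.map σ)
    (hT : T * T.map σ = -δ • (1 : Mat m)) : PsiSystem A s q r Φ Ψ := by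
  have h1 := twist_mulVec hAT
  have h2 := twist_inv_mulVec_of_nonlocal hA h1
  have h3 : ∀ n t, twist T σ (Ψ (1 - n) (-t)) = -δ • Φ n t := fun n t => by
    rw [hΨ, twist_twist hσ hT, sub_sub_cancel, neg_neg]
  have hσδ : σ δ = δ := map_sign hδ
  have hq : ∀ n t, σ (q (-n) (-t)) = δ * r n t := fun n t => by
    rw [hr, ← mul_assoc, mul_self_of_sign hδ, one_mul]
  have hσr : ∀ n t, σ (r (-n) (-t)) = δ * q n t := fun n t => by
    rw [hr, map_mul, hσ, hσδ, neg_neg, neg_neg]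
  constructor
  · intro n t
    have e1 : s n t • Ψ n t = A.mulVec (Ψ (n + 1) t) - r n t • Φ (n + 1) t := by
      have h := congrArg (twist T σ) (hΦ.smul_space hα (-n) (-t))
      have i1 : -n + 1 = 1 - n := by ring
      have i2 : -n = 1 - (n + 1) := by ring
      rw [twist_smul, twist_add, twist_smul, h1, hs, hq, i1, ← hΨ] at h
      rw [i2, ← hΨ, h3, smul_smul] at h
      rw [h, sub_eq_add_neg, ← neg_smul]
      congr 2
      linear_combination (-r n t) * mul_self_of_sign hδ
    have e2 := hΦ.smul_space hα n t
    have hne := hα.ne_zero n t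
    have e3 : s n t • A.mulVec (Ψ (n + 1) t) = r n t • A.mulVec (Φ n t) + Ψ n t := by
      have e4 : A.mulVec (Ψ (n + 1) t) = s n t • Ψ n t + r n t • Φ (n + 1) t := by
        rw [e1]; abel
      rw [e4, smul_add, smul_comm (s n t) (r n t), e2, smul_smul, ← pow_two, hα.sq_eq]
      module
    have e5 := congrArg A⁻¹.mulVec e3
    rw [Matrix.mulVec_smul, Matrix.mulVec_mulVec, Matrix.nonsing_inv_mul A hA, Matrix.one_mulVec,
      Matrix.mulVec_add, Matrix.mulVec_smul, Matrix.mulVec_mulVec, Matrix.nonsing_inv_mul A hA,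
      Matrix.one_mulVec] at e5
    rw [← e5, smul_smul, inv_mul_cancel₀ hne, one_smul]
  · intro n t
    have hder : HasDerivAt (fun τ : ℝ => Φ (1 - n) (-τ)) _ t :=
      (hΦ.time (1 - n) (-t)).scomp t (hasDerivAt_neg t)
    have i1 : 1 - n = -(n - 1) := by ring
    have i2 : 1 - n - 1 = -n := by ring
    have hq₁ : σ (q (1 - n) (-t)) = δ * r (n - 1) t := by rw [i1, hq]
    have hq₂ : σ (q (1 - n - 1) (-t)) = δ * r n t := by rw [i2, hq]
    have hr₁ : σ (r (1 - n) (-t)) = δ * q (n - 1) t := by rw [i1, hσr]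
    have hr₂ : σ (r (1 - n - 1) (-t)) = δ * q n t := by rw [i2, hσr]
    have hneg : ∀ v : Fin (2 * m + 2) → ℂ, (-1 : ℝ) • v = (-1 : ℂ) • v := fun v => by simp
    have hd := hasDerivAt_twist (T := T) hσ' hder
    simp only [← hΨ] at hd
    refine hd.congr_deriv ?_
    simp only [hneg, Matrix.add_mulVec, Matrix.sub_mulVec, Matrix.smul_mulVec, Matrix.one_mulVec,
      Matrix.mulVec_smul, twist_add, twist_sub, twist_smul, twist_pow_mulVec h1,
      twist_pow_mulVec h2, h1, h2, h3, ← hΨ, map_neg, map_sub, map_mul, map_div₀, map_ofNat,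
      map_one, hq₁, hq₂, hr₁, hr₂]
    rcases hδ with rfl | rfl <;> module

/-- The map `T σ` sends the columns of `F` at the reflected point to those of `F` with the blocks
exchanged, up to scalar factors. -/
theorem casF_of_nonlocal (hσ : ∀ z, σ (σ z) = z) (hs : ∀ n t, σ (s (-n) (-t)) = s n t)
    (hΨ : ∀ n t, Ψ n t = twist T σ (Φ (1 - n) (-t))) (hAT : A * T = T * A.map σ)
    (hT : T * T.map σ = -δ • (1 : Mat m)) (n : ℤ) (t : ℝ) :
    T.det * σ (casF A s Φ Ψ (-n) (-t)) = δ ^ (m + 1) * casF A s Φ Ψ n t := by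
  have h1 := twist_pow_mulVec (twist_mulVec hAT)
  have h3 : twist T σ (Ψ (-n) (-t)) = -δ • Φ (n + 1) t := by
    rw [hΨ, twist_twist hσ hT, sub_neg_eq_add, add_comm 1 n, neg_neg]
  have h4 : twist T σ (Φ (-n + 1) (-t)) = Ψ n t := by
    rw [hΨ, neg_add_eq_sub]
  have h5 := casoratian_twist (T := T) (σ := σ) 1
    (fun j => (A ^ (2 * j)).mulVec (Φ (-n + 1) (-t))) (fun j => (A ^ (2 * j)).mulVec (Ψ (-n) (-t)))
  simp only [one_mul, Matrix.one_mulVec, h1, h3, h4, Matrix.mulVec_smul] at h5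
  have h6 := casoratian_smul_const (m := m) (u := fun j => (A ^ (2 * j)).mulVec (Ψ n t))
    (v := fun j => (A ^ (2 * j)).mulVec (Φ (n + 1) t)) 1 (-δ)
  simp only [one_smul, one_pow, one_mul] at h6
  rw [casF_eq_casoratian, casF_eq_casoratian, map_mul, map_pow, hs, mul_left_comm, ← h5, h6,
    casoratian_swap, neg_pow δ]
  have hsq : (-1 : ℂ) ^ (m + 1) * (-1) ^ (m + 1) = 1 := by rw [← mul_pow]; simp
  linear_combination s n t ^ (m + 1) * δ ^ (m + 1) * casoratian m
    (fun j => (A ^ (2 * j)).mulVec (Φ (n + 1) t)) (fun j => (A ^ (2 * j)).mulVec (Ψ n t)) * hsq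

/-- The map `T σ` sends the columns of `G` at the reflected point to those of `H`, up to order
and scalar factors. -/
theorem casG_of_nonlocal (hσ : ∀ z, σ (σ z) = z) (hs : ∀ n t, σ (s (-n) (-t)) = s n t)
    (hΨ : ∀ n t, Ψ n t = twist T σ (Φ (1 - n) (-t))) (hAT : A * T = T * A.map σ)
    (hT : T * T.map σ = -δ • (1 : Mat m)) (n : ℤ) (t : ℝ) :
    T.det * σ (casG A s Φ Ψ (-n) (-t)) = δ ^ m * casH A s Φ Ψ n t := by
  have h1 := twist_pow_mulVec (twist_mulVec hAT)
  have h3 : twist T σ (Ψ (-n) (-t)) = -δ • Φ (n + 1) t := by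
    rw [hΨ, twist_twist hσ hT, sub_neg_eq_add, add_comm 1 n, neg_neg]
  have h4 : twist T σ (Φ (-n + 1) (-t)) = Ψ n t := by
    rw [hΨ, neg_add_eq_sub]
  have h4' : twist T σ (Φ (-n) (-t)) = Ψ (n + 1) t := by
    rw [hΨ, sub_add_cancel_right]
  -- the blocks of `H`, the last columns being exchanged
  let U : ℕ → Fin (2 * m + 2) → ℂ := fun j =>
    if j = m then (A ^ (2 * j + 1)).mulVec (Ψ n t) else (A ^ (2 * j + 1)).mulVec (Φ (n + 1) t)
  let V : ℕ → Fin (2 * m + 2) → ℂ := fun j =>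
    if j = m then Ψ (n + 1) t else (A ^ (2 * j + 1)).mulVec (Ψ n t)
  have hH : casH A s Φ Ψ n t = s n t ^ (m + 1) * -casoratian m U V := by
    rw [casH_eq_casoratian, ← casoratian_exchange_last]
    congr 2
    · funext j
      by_cases hj : j = m <;> simp [U, V, hj]
    · funext j
      by_cases hj : j = m <;> simp [U, V, hj]
  have h5 := casoratian_twist (T := T) (σ := σ) 1
    (fun j => if j = 0 then Φ (-n) (-t) else (A ^ (2 * j - 1)).mulVec (Φ (-n + 1) (-t)))
    (fun j => if j = 0 then (A ^ (2 * m + 1)).mulVec (Φ (-n + 1) (-t))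
      else (A ^ (2 * j - 1)).mulVec (Ψ (-n) (-t)))
  simp only [one_mul, Matrix.one_mulVec, apply_ite (twist T σ), h1, h3, h4, h4',
    Matrix.mulVec_smul] at h5
  have h6 := casoratian_smul (m := m)
    (u := fun j => if j = 0 then Ψ (n + 1) t else (A ^ (2 * j - 1)).mulVec (Ψ n t))
    (v := fun j => if j = 0 then (A ^ (2 * m + 1)).mulVec (Ψ n t)
      else (A ^ (2 * j - 1)).mulVec (Φ (n + 1) t))
    (fun _ => 1) (fun j => if j = 0 then 1 else -δ)
  rw [Finset.prod_range_succ' (fun j => if j = 0 then 1 else -δ)] at h6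
  simp only [Nat.succ_ne_zero, if_true, if_false, Finset.prod_const, Finset.card_range, one_pow,
    mul_one, one_mul, one_smul] at h6
  have h7 : casoratian m
      (fun j => if j = 0 then Ψ (n + 1) t else (A ^ (2 * j - 1)).mulVec (Ψ n t))
      (fun j => if j = 0 then (A ^ (2 * m + 1)).mulVec (Ψ n t)
        else (A ^ (2 * j - 1)).mulVec (Φ (n + 1) t)) = casoratian m V U := by
    refine casoratian_rotate.symm.trans
      (casoratian_congr (fun j _ => ?_) (fun j _ => ?_))
    · have e : 2 * (j + 1) - 1 = 2 * j + 1 := by omega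
      by_cases hj : j = m <;> simp [V, hj, e]
    · have e : 2 * (j + 1) - 1 = 2 * j + 1 := by omega
      by_cases hj : j = m <;> simp [U, hj, e]
  have h8 : (fun j => (if j = 0 then (1 : ℂ) else -δ) •
      (if j = 0 then (A ^ (2 * m + 1)).mulVec (Ψ n t)
        else (A ^ (2 * j - 1)).mulVec (Φ (n + 1) t)))
      = fun j => if j = 0 then (A ^ (2 * m + 1)).mulVec (Ψ n t)
        else -δ • (A ^ (2 * j - 1)).mulVec (Φ (n + 1) t) := by
    funext j
    by_cases hj : j = 0 <;> simp [hj]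
  rw [casG_eq_casoratian, map_mul, map_pow, hs, mul_left_comm, ← h5, ← h8, h6, h7,
    casoratian_swap, hH, neg_pow δ]
  have hsq : (-1 : ℂ) ^ m * (-1) ^ m = 1 := by rw [← mul_pow]; simp
  linear_combination -s n t ^ (m + 1) * δ ^ m * casoratian m U V * hsq
end
end

/-! ### The reduced equations -/

section
variable {m : ℕ} {δ : ℂ} {A T : Mat m} {q r s : Field1} {Φ Ψ : VecField m} {σ : ℂ →+* ℂ}

/-- If `F = δ c F̂` and `H = c Ĝ`, then `R = δ Q̂` with `Q̂ = Ĝ / F̂`. -/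
theorem solR_eq_of_reduction {n : ℤ} {t : ℝ} {c Fh Gh : ℂ} (hδ : δ = 1 ∨ δ = -1)
    (hF : casF A s Φ Ψ n t = δ * c * Fh) (hH : casH A s Φ Ψ n t = c * Gh)
    (hne : casF A s Φ Ψ n t ≠ 0) : solR A s Φ Ψ n t = δ * (Gh / Fh) := by
  have hne' := hne
  rw [hF] at hne'
  have hc : c ≠ 0 := fun h => hne' (by rw [h]; ring)
  have hFh : Fh ≠ 0 := fun h => hne' (by rw [h]; ring)
  have hδ0 : δ ≠ 0 := fun h => hne' (by rw [h]; ring)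
  rw [solR, hF, hH]
  field_simp
  rw [pow_two, mul_self_of_sign hδ, mul_one]

/-- If `R = δ Q̂`, the covariance of the unreduced system becomes the reduced equation. -/
theorem solvesWhereDefined_of_reduction (hA : IsUnit A.det) (hqr : IsCoupledSolution q r)
    (hs : IsSqrtAlpha q r s) (hΦ : PhiSystem A s q r Φ Ψ) (hΨ : PsiSystem A s q r Φ Ψ)
    {Qhat : Field1}
    (hR : ∀ n t, casF A s Φ Ψ n t ≠ 0 → solR A s Φ Ψ n t = δ * Qhat n t) :
    SolvesWhereDefined δ (casF A s Φ Ψ) (solQ A s Φ Ψ) Qhat := by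
  intro n t h1 h2 h3
  refine (hasDerivAt_solQ hA hqr hs hΦ hΨ h1 h2 h3).congr_deriv ?_
  rw [hR n t h2]
  ring

/-- The local reductions `r = δ σ(q)`, `Ψ = T σ(Φ)`. -/
theorem reduction_of_local (hδ : δ = 1 ∨ δ = -1) (hA : IsUnit A.det)
    (hqr : IsCoupledSolution q r) (hα : IsSqrtAlpha q r s) (hΦ : PhiSystem A s q r Φ Ψ)
    (hσ : ∀ z, σ (σ z) = z) (hσ' : CommutesWithDeriv σ)
    (hr : ∀ n t, r n t = δ * σ (q n t)) (hs : ∀ n t, σ (s n t) = s n t)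
    (hΨ : ∀ n t, Ψ n t = twist T σ (Φ n t)) (hAT : A⁻¹ * T = T * A.map σ)
    (hT : T * T.map σ = δ • (1 : Mat m)) :
    PsiSystem A s q r Φ Ψ ∧
    (∀ n t, casF A s Φ Ψ n t
      = (-δ) ^ (m + 1) * (A ^ (2 * m + 1) * T).det * σ (casF A s Φ Ψ n t)) ∧
    (∀ n t, casH A s Φ Ψ n t
      = -(-δ) ^ m * (A ^ (2 * m + 1) * T).det * σ (casG A s Φ Ψ n t)) ∧
    (∀ n t, casF A s Φ Ψ n t ≠ 0 → solR A s Φ Ψ n t = δ * σ (solQ A s Φ Ψ n t)) ∧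
    SolvesWhereDefined δ (casF A s Φ Ψ) (solQ A s Φ Ψ) (fun n t => σ (solQ A s Φ Ψ n t)) := by
  have hΨs := psiSystem_of_local hA hΦ hσ hσ' hδ hr hs hΨ hAT hT
  have hsq : ∀ k : ℕ, (-δ) ^ k * (-δ) ^ k = 1 := fun k => by
    rw [← mul_pow, neg_mul_neg, mul_self_of_sign hδ, one_pow]
  have hF : ∀ n t, casF A s Φ Ψ n t
      = (-δ) ^ (m + 1) * (A ^ (2 * m + 1) * T).det * σ (casF A s Φ Ψ n t) := fun n t => by
    linear_combination -(-δ) ^ (m + 1) * casF_of_local hA hΨs hα hΦ hσ hs hΨ hAT hT n t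
      - casF A s Φ Ψ n t * hsq (m + 1)
  have hH : ∀ n t, casH A s Φ Ψ n t
      = -(-δ) ^ m * (A ^ (2 * m + 1) * T).det * σ (casG A s Φ Ψ n t) := fun n t => by
    linear_combination (-δ) ^ m * casG_of_local hA hΨs hα hΦ hσ hs hΨ hAT hT n t
      - casH A s Φ Ψ n t * hsq m
  have hR : ∀ n t, casF A s Φ Ψ n t ≠ 0 → solR A s Φ Ψ n t = δ * σ (solQ A s Φ Ψ n t) :=
    fun n t hne => by
      rw [solQ, map_div₀]
      refine solR_eq_of_reduction hδ ((hF n t).trans ?_) (hH n t) hne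
      ring
  exact ⟨hΨs, hF, hH, hR, solvesWhereDefined_of_reduction hA hqr hα hΦ hΨs hR⟩

/-- The nonlocal reductions `r = δ σ(q(-n, -t))`, `Ψ = T σ(Φ(1 - n, -t))`. -/
theorem reduction_of_nonlocal (hδ : δ = 1 ∨ δ = -1) (hA : IsUnit A.det)
    (hqr : IsCoupledSolution q r) (hα : IsSqrtAlpha q r s) (hΦ : PhiSystem A s q r Φ Ψ)
    (hσ : ∀ z, σ (σ z) = z) (hσ' : CommutesWithDeriv σ)
    (hr : ∀ n t, r n t = δ * σ (q (-n) (-t))) (hs : ∀ n t, σ (s (-n) (-t)) = s n t)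
    (hΨ : ∀ n t, Ψ n t = twist T σ (Φ (1 - n) (-t))) (hAT : A * T = T * A.map σ)
    (hT : T * T.map σ = -δ • (1 : Mat m)) :
    PsiSystem A s q r Φ Ψ ∧
    (∀ n t, casF A s Φ Ψ n t = δ ^ (m + 1) * T.det * σ (casF A s Φ Ψ (-n) (-t))) ∧
    (∀ n t, casH A s Φ Ψ n t = δ ^ m * T.det * σ (casG A s Φ Ψ (-n) (-t))) ∧
    (∀ n t, casF A s Φ Ψ n t ≠ 0 → solR A s Φ Ψ n t = δ * σ (solQ A s Φ Ψ (-n) (-t))) ∧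
    SolvesWhereDefined δ (casF A s Φ Ψ) (solQ A s Φ Ψ)
      (fun n t => σ (solQ A s Φ Ψ (-n) (-t))) := by
  have hΨs := psiSystem_of_nonlocal hA hα hΦ hσ hσ' hδ hr hs hΨ hAT hT
  have hsq : ∀ k : ℕ, δ ^ k * δ ^ k = 1 := fun k => by
    rw [← mul_pow, mul_self_of_sign hδ, one_pow]
  have hF : ∀ n t, casF A s Φ Ψ n t = δ ^ (m + 1) * T.det * σ (casF A s Φ Ψ (-n) (-t)) :=
    fun n t => by
      linear_combination -δ ^ (m + 1) * casF_of_nonlocal hσ hs hΨ hAT hT n t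
        - casF A s Φ Ψ n t * hsq (m + 1)
  have hH : ∀ n t, casH A s Φ Ψ n t = δ ^ m * T.det * σ (casG A s Φ Ψ (-n) (-t)) :=
    fun n t => by
      linear_combination -δ ^ m * casG_of_nonlocal hσ hs hΨ hAT hT n t
        - casH A s Φ Ψ n t * hsq m
  have hR : ∀ n t, casF A s Φ Ψ n t ≠ 0 →
      solR A s Φ Ψ n t = δ * σ (solQ A s Φ Ψ (-n) (-t)) := fun n t hne => by
    rw [solQ, map_div₀]
    refine solR_eq_of_reduction hδ ((hF n t).trans ?_) (hH n t) hne
    ring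
  exact ⟨hΨs, hF, hH, hR, solvesWhereDefined_of_reduction hA hqr hα hΦ hΨs hR⟩

/-- In the classical real case `|A|² = |T|² = 1`, so that the constant equals its inverse. -/
theorem inv_det_eq_self_of_local (hδ : δ = 1 ∨ δ = -1) (hA : IsUnit A.det)
    (hAT : A⁻¹ * T = T * A) (hT : T * T = δ • (1 : Mat m)) :
    (A ^ (2 * m + 1) * T).det⁻¹ = (A ^ (2 * m + 1) * T).det := by
  have h1 : T.det * T.det = 1 := by
    rw [← Matrix.det_mul, hT, Matrix.det_smul, Matrix.det_one, mul_one, Fintype.card_fin,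
      show 2 * m + 2 = 2 * (m + 1) by ring, pow_mul, pow_two, mul_self_of_sign hδ, one_pow]
  have hT0 : T.det ≠ 0 := left_ne_zero_of_mul_eq_one h1
  have h2 : A.det * A.det = 1 := by
    have h := congrArg (fun N => A * N) hAT
    simp only [← mul_assoc, Matrix.mul_nonsing_inv A hA, one_mul] at h
    have h' := congrArg Matrix.det h
    rw [Matrix.det_mul, Matrix.det_mul] at h'
    exact mul_right_cancel₀ hT0 (by linear_combination -h')
  refine inv_eq_of_mul_eq_one_left ?_
  rw [Matrix.det_mul, Matrix.det_pow, mul_mul_mul_comm, ← mul_pow, h1, h2, one_pow, one_mul]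

/-- In the nonlocal real case `|T|² = 1`, so that the constant equals its inverse. -/
theorem inv_det_eq_self_of_nonlocal (hδ : δ = 1 ∨ δ = -1) (hT : T * T = -δ • (1 : Mat m)) :
    T.det⁻¹ = T.det := by
  have h1 : T.det * T.det = 1 := by
    rw [← Matrix.det_mul, hT, Matrix.det_smul, Matrix.det_one, mul_one, Fintype.card_fin,
      show 2 * m + 2 = 2 * (m + 1) by ring, pow_mul, pow_two, neg_mul_neg, mul_self_of_sign hδ,
      one_pow]
  exact inv_eq_of_mul_eq_one_left h1

end
end

theorem theorem2 (m : ℕ) (δ : ℂ) (hδ : δ = 1 ∨ δ = -1)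
    (A T : Mat m) (hA : IsUnit A.det)
    (q r s : Field1) (hqr : IsCoupledSolution q r) (hs : IsSqrtAlpha q r s)
    (Φ Ψ : VecField m) (hΦ : PhiSystem A s q r Φ Ψ) :
    -- classical real equation
    ((∀ n t, r n t = δ * q n t) →
      (∀ n t, Ψ n t = T.mulVec (Φ n t)) →
      A⁻¹ * T = T * A → T * T = δ • (1 : Mat m) →
      PsiSystem A s q r Φ Ψ ∧
      (∀ n t, casF A s Φ Ψ n t
        = (-δ) ^ (m + 1) * (A ^ (2 * m + 1) * T).det⁻¹ * casF A s Φ Ψ n t) ∧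
      (∀ n t, casH A s Φ Ψ n t
        = -(-δ) ^ m * (A ^ (2 * m + 1) * T).det⁻¹ * casG A s Φ Ψ n t) ∧
      (∀ n t, casF A s Φ Ψ n t ≠ 0 → solR A s Φ Ψ n t = δ * solQ A s Φ Ψ n t) ∧
      SolvesWhereDefined δ (casF A s Φ Ψ) (solQ A s Φ Ψ) (solQ A s Φ Ψ)) ∧
    -- classical complex equation
    ((∀ n t, r n t = δ * conj (q n t)) →
      (∀ n t, conj (s n t) = s n t) →
      (∀ n t, Ψ n t = T.mulVec (vecConj (Φ n t))) →
      A⁻¹ * T = T * A.cj → T * T.cj = δ • (1 : Mat m) →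
      PsiSystem A s q r Φ Ψ ∧
      (∀ n t, casF A s Φ Ψ n t
        = (-δ) ^ (m + 1) * (A ^ (2 * m + 1) * T).det * conj (casF A s Φ Ψ n t)) ∧
      (∀ n t, casH A s Φ Ψ n t
        = -(-δ) ^ m * (A ^ (2 * m + 1) * T).det * conj (casG A s Φ Ψ n t)) ∧
      (∀ n t, casF A s Φ Ψ n t ≠ 0 → solR A s Φ Ψ n t = δ * conj (solQ A s Φ Ψ n t)) ∧
      SolvesWhereDefined δ (casF A s Φ Ψ) (solQ A s Φ Ψ)
        (fun n t => conj (solQ A s Φ Ψ n t))) ∧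
    -- nonlocal real reverse-space-time equation
    ((∀ n t, r n t = δ * q (-n) (-t)) →
      (∀ n t, s (-n) (-t) = s n t) →
      (∀ n t, Ψ n t = T.mulVec (Φ (1 - n) (-t))) →
      A * T = T * A → T * T = -δ • (1 : Mat m) →
      PsiSystem A s q r Φ Ψ ∧
      (∀ n t, casF A s Φ Ψ n t = δ ^ (m + 1) * T.det⁻¹ * casF A s Φ Ψ (-n) (-t)) ∧
      (∀ n t, casH A s Φ Ψ n t = δ ^ m * T.det⁻¹ * casG A s Φ Ψ (-n) (-t)) ∧
      (∀ n t, casF A s Φ Ψ n t ≠ 0 → solR A s Φ Ψ n t = δ * solQ A s Φ Ψ (-n) (-t)) ∧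
      SolvesWhereDefined δ (casF A s Φ Ψ) (solQ A s Φ Ψ)
        (fun n t => solQ A s Φ Ψ (-n) (-t))) ∧
    -- nonlocal complex reverse-space-time equation
    ((∀ n t, r n t = δ * conj (q (-n) (-t))) →
      (∀ n t, conj (s (-n) (-t)) = s n t) →
      (∀ n t, Ψ n t = T.mulVec (vecConj (Φ (1 - n) (-t)))) →
      A * T = T * A.cj → T * T.cj = -δ • (1 : Mat m) →
      PsiSystem A s q r Φ Ψ ∧
      (∀ n t, casF A s Φ Ψ n t = δ ^ (m + 1) * T.det * conj (casF A s Φ Ψ (-n) (-t))) ∧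
      (∀ n t, casH A s Φ Ψ n t = δ ^ m * T.det * conj (casG A s Φ Ψ (-n) (-t))) ∧
      (∀ n t, casF A s Φ Ψ n t ≠ 0 → solR A s Φ Ψ n t = δ * conj (solQ A s Φ Ψ (-n) (-t))) ∧
      SolvesWhereDefined δ (casF A s Φ Ψ) (solQ A s Φ Ψ)
        (fun n t => conj (solQ A s Φ Ψ (-n) (-t)))) := by
  refine ⟨fun hr hΨ hAT hT => ?_, fun hr hsc hΨ hAT hT => ?_, fun hr hsc hΨ hAT hT => ?_,
    fun hr hsc hΨ hAT hT => ?_⟩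
  · rw [inv_det_eq_self_of_local hδ hA hAT hT]
    exact reduction_of_local (σ := RingHom.id ℂ) hδ hA hqr hs hΦ (fun _ => rfl)
      commutesWithDeriv_id hr (fun _ _ => rfl) hΨ hAT hT
  · exact reduction_of_local (σ := starRingEnd ℂ) hδ hA hqr hs hΦ Complex.conj_conj
      commutesWithDeriv_conj hr hsc hΨ hAT hT
  · rw [inv_det_eq_self_of_nonlocal hδ hT]
    exact reduction_of_nonlocal (σ := RingHom.id ℂ) hδ hA hqr hs hΦ (fun _ => rfl)
      commutesWithDeriv_id hr hsc hΨ hAT hT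
  · exact reduction_of_nonlocal (σ := starRingEnd ℂ) hδ hA hqr hs hΦ Complex.conj_conj
      commutesWithDeriv_conj hr hsc hΨ hAT hT
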